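/- **Setting.** Let $F_0\in\mathbb{C}^N$, $F_1\in\mathbb{C}^{N\times N}$, $0\neq F_2\in\mathbb{C}^{N\times N^2}$, and let $x:[0,\infty)\to\mathbb{C}^N$ solve $\dot x=F_0+F_1x+F_2x^{\otimes 2}$. Let the system have $M$ linear conserved quantities $q^{(m)\dagger}x$, $m=1,\dots,M$, i.e. $q^{(m)\dagger}(F_0+F_1v+F_2v^{\otimes2})=0$ for every $v\in\mathbb{C}^N$. Assume $F_1=Q\Lambda Q^{-1}$ with $\Lambda$ diagonal, that the only eigenvalues of $F_1$ with non-negative real part are the zero eigenvalues related to the conserved quantities (if $\mathrm{Re}\,\Lambda_{ii}\ge0$, then $\Lambda_{ii}=0$ and the $i$-th row of $Q^{-1}$ is a linear combination of the $q^{(m)\dagger}$), and that some eigenvalue has nonzero real part. Let $\delta(F_1)=-\max\{\mathrm{Re}\,\lambda:\lambda\text{ an eigenvalue of }F_1,\ \mathrm{Re}\,\lambda\ne0\}$ be the real spectral gap. Suppose $\|Q^{-1}x(t)\|\le\|\tilde x_{\max}\|$ for all $t\ge0$, where $\|\tilde x_{\max}\|$ is a real number. Vectors carry the Euclidean norm,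 matrices the spectral norm. **Embedding.** For $\gamma>0$ and real $\upsilon\ne0$ consider the rescaled variable $\bar x=\gamma x$, with $\bar F_0=\gamma F_0$, $\bar F_1=F_1$, $\bar F_2=F_2/\gamma$, and the undriven $(N+1)$-dimensional system $$\dot z=G_1z+G_2z^{\otimes2},\qquad z(0)=[\gamma x(0),\gamma\upsilon],$$ $$G_1=\sum_{i,j=1}^N(F_1)_{i,j}|i\rangle\langle j|,\qquad G_2=\sum_{i,j,l=1}^N(\bar F_2)_{i,jl}|i\rangle\langle jl|+\sum_{i=1}^N\frac{(\bar F_0)_i}{\gamma^2\upsilon^2}|i\rangle\langle N+1,N+1|.$$ For $k\ge1$, its Carleman system truncated at level $k$ is, for $1\le j\le k$, $$\tfrac{d}{dt}y^{[j]}=A_{j,j}y^{[j]}+A_{j,j+1}y^{[j+1]}\ (j<k),\qquad \tfrac{d}{dt}y^{[k]}=A_{k,k}y^{[k]},\qquad y^{[j]}(0)=z(0)^{\otimes j},$$ where $A_{j,j}=\sum_{l=0}^{j-1}I^{\otimes l}\otimes G_1\otimes I^{\otimes(j-1-l)}$ and $A_{j,j+1}=\sum_{l=0}^{j-1}I^{\otimes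 l}\otimes G_2\otimes I^{\otimes(j-1-l)}$. Let $\mathcal{D}_j$ discard from $y^{[j]}$ all entries involving the label $N+1$. Put $$\gamma_0=\frac{e\,\|Q^{-1}F_2Q^{\otimes2}\|}{\delta(F_1)\|Q\|},\qquad R_{\delta,\upsilon}=\frac{2e\sqrt{\|\tilde x_{\max}\|^2+\upsilon^2}\,\max\{\|Q^{-1}F_2Q^{\otimes2}\|,\ \|Q^{-1}F_0\|/\upsilon^2\}}{\delta(F_1)},$$ $$\upsilon_*=\sqrt{\frac{\|Q^{-1}F_0\|}{\|Q^{-1}F_2Q^{\otimes2}\|}},\qquad R_\delta=\frac{2e\,\|Q^{-1}F_2Q^{\otimes2}\|\sqrt{\|\tilde x_{\max}\|^2+\frac{\|Q^{-1}F_0\|}{\|Q^{-1}F_2Q^{\otimes2}\|}}}{\delta(F_1)}.$$ **Claim.** 1. For all $\gamma>0$ and $\upsilon\neq0$, the solution of the embedded system is $z(t)=[\gamma x(t),\gamma\upsilon]$, and it is unique. 2. We have $\gamma_0>0$, and for all $\upsilon\ne0$, $\gamma=p\gamma_0$ with $p\in(0,1]$, $k\ge1$, $1\le j\le k$ and $t\ge0$,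 $$\big\|(\gamma x(t))^{\otimes j}-\mathcal{D}_jy^{[j]}(t)\big\|\le\frac{j}{2(k+1)}\,p^j\,R_{\delta,\upsilon}^{\,k+1}.$$ 3. If $F_0\neq0$, then $\upsilon_*>0$, $\upsilon_*$ minimizes $R_{\delta,\upsilon}$ over $\upsilon\ne0$ (uniquely up to sign), and $R_{\delta,\upsilon_*}=R_\delta$. 4. If $R_\delta<1$, then there is $\upsilon>0$, namely $\upsilon=\upsilon_*$ when $F_0\ne0$, with $R_{\delta,\upsilon}<1$ and such that for all $\gamma=p\gamma_0$ with $p\in(0,1]$ the total error $$\Big(\sum_{j=1}^k\big\|(\gamma x(t))^{\otimes j}-\mathcal{D}_jy^{[j]}(t)\big\|^2\Big)^{1/2}$$ tends to $0$ as $k\to\infty$, uniformly in $t\ge0$. -/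

import Mathlib

open scoped Matrix Kronecker Matrix.Norms.L2Operator

noncomputable section

/-- The Euclidean norm of a complex vector. (On matrices `‖·‖` denotes the spectral norm, i.e. the
operator norm with respect to the Euclidean norms.) -/
def euclNorm {κ : Type*} [Fintype κ] (v : κ → ℂ) : ℝ := ‖WithLp.toLp 2 v‖

/-- The coefficients of the quadratic system `x' = F0 + F1 x + F2 (x ⊗ x)` on `ℂ^κ`;
`F2` is an arbitrary linear map from `ℂ^κ ⊗ ℂ^κ = ℂ^(κ × κ)` to `ℂ^κ`. -/
structure QuadSystem (κ : Type*) where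
  F0 : κ → ℂ
  F1 : Matrix κ κ ℂ
  F2 : Matrix κ (κ × κ) ℂ

/-- The tensor power `v^{⊗ j}`, with entries indexed by words of length `j`. -/
def tensorPow {κ : Type*} (v : κ → ℂ) (j : ℕ) : (Fin j → κ) → ℂ := fun α => ∏ i, v (α i)

namespace QuadSystem

variable {κ : Type*} [Fintype κ]

/-- The right-hand side `F0 + F1 v + F2 (v ⊗ v)`. -/
def field (S : QuadSystem κ) (v : κ → ℂ) : κ → ℂ :=
  S.F0 + S.F1 *ᵥ v + S.F2 *ᵥ (fun s : κ × κ => v s.1 * v s.2)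

/-- `x` solves the quadratic system on `[0, ∞)`. -/
def IsSolution (S : QuadSystem κ) (x : ℝ → κ → ℂ) : Prop :=
  ∀ t : ℝ, 0 ≤ t → HasDerivWithinAt x (S.field (x t)) (Set.Ici 0) t

/-- The linear functional `q† x` is a conserved quantity: its time derivative
`q† (F0 + F1 v + F2 (v ⊗ v))` along the dynamics vanishes at every state `v`. -/
def IsConserved (S : QuadSystem κ) (q : κ → ℂ) : Prop :=
  ∀ v : κ → ℂ, star q ⬝ᵥ S.field v = 0

/-- The change of units `x ↦ γ x`. -/
def rescale (S : QuadSystem κ) (γ : ℝ) : QuadSystem κ where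
  F0 := (γ : ℂ) • S.F0
  F1 := S.F1
  F2 := ((γ : ℂ)⁻¹) • S.F2

/-- The undriven system with one extra coordinate (labelled `Sum.inr ()`), in which the driving term
`F0` is replaced by the quadratic term `F0 / c ^ 2` times the square of the extra coordinate. -/
def absorb (S : QuadSystem κ) (c : ℝ) : QuadSystem (κ ⊕ Unit) where
  F0 := 0
  F1 := Matrix.fromBlocks S.F1 0 0 0
  F2 := Matrix.of fun r s =>
    match r, s with
    | Sum.inl i, (Sum.inl a, Sum.inl b) => S.F2 i (a, b)
    | Sum.inl i, (Sum.inr _, Sum.inr _) => S.F0 i / (c : ℂ) ^ 2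
    | _, _ => 0

/-- The Carleman block `A_{j+1,j} = ∑ₗ I^{⊗ l} ⊗ F0 ⊗ I^{⊗ (j - l)}`, as a map. -/
def carlemanDown (S : QuadSystem κ) {j : ℕ} (y : (Fin j → κ) → ℂ) : (Fin (j + 1) → κ) → ℂ :=
  fun α => ∑ l : Fin (j + 1), S.F0 (α l) * y (l.removeNth α)

/-- The Carleman block `A_{j,j} = ∑ₗ I^{⊗ l} ⊗ F1 ⊗ I^{⊗ (j - 1 - l)}`, as a map. -/
def carlemanDiag (S : QuadSystem κ) {j : ℕ} (y : (Fin j → κ) → ℂ) : (Fin j → κ) → ℂ :=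
  fun α => ∑ l : Fin j, ∑ a, S.F1 (α l) a * y (Function.update α l a)

/-- The Carleman block `A_{j,j+1} = ∑ₗ I^{⊗ l} ⊗ F2 ⊗ I^{⊗ (j - 1 - l)}`, as a map: in the `l`-th
summand the letters number `l` and `l + 1` of the word of length `j + 1` are contracted by `F2`. -/
def carlemanUp (S : QuadSystem κ) {j : ℕ} (y : (Fin (j + 1) → κ) → ℂ) : (Fin j → κ) → ℂ :=
  fun α => ∑ l : Fin j, ∑ a, ∑ b,
    S.F2 (α l) (a, b) * y (l.succ.insertNth b (Function.update α l a))

/-- `y = (y^{[1]}, …, y^{[k]})` solves, on `[0, ∞)`, the Carleman system of `S` truncated at level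
`k`, with initial value `(x₀, x₀^{⊗ 2}, …, x₀^{⊗ k})`; here `y^{[0]} = 1`, and entries `y j` with
`j > k` are not constrained and not used. -/
def IsCarlemanSolution (S : QuadSystem κ) (k : ℕ) (x₀ : κ → ℂ)
    (y : (j : ℕ) → ℝ → (Fin j → κ) → ℂ) : Prop :=
  (∀ t, y 0 t = fun _ => 1) ∧
  ∀ i < k, y (i + 1) 0 = tensorPow x₀ (i + 1) ∧
    ∀ t : ℝ, 0 ≤ t →
      HasDerivWithinAt (y (i + 1))
        (S.carlemanDown (y i t) + S.carlemanDiag (y (i + 1) t) +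
          if i + 1 < k then S.carlemanUp (y (i + 2) t) else 0)
        (Set.Ici 0) t

end QuadSystem

/-- The state `[v, c]` with one extra coordinate equal to `c`. -/
def appendCoord {κ : Type*} (v : κ → ℂ) (c : ℝ) : κ ⊕ Unit → ℂ := Sum.elim v fun _ => (c : ℂ)

/-- The operation `D_j`: discard all entries whose word contains the extra label. -/
def discardExtra {κ : Type*} {j : ℕ} (w : (Fin j → κ ⊕ Unit) → ℂ) : (Fin j → κ) → ℂ :=
  fun α => w fun i => Sum.inl (α i)

/-- The real spectral gap: minus the largest nonzero real part of an eigenvalue. -/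
def realSpectralGap {κ : Type*} [Fintype κ] [DecidableEq κ] (A : Matrix κ κ ℂ) : ℝ :=
  -sSup (Complex.re '' {μ ∈ spectrum ℂ A | μ.re ≠ 0})

namespace QuadSystem

variable {κ : Type*} [Fintype κ] [DecidableEq κ]

/-- The norm of `Q⁻¹ F2 Q^{⊗ 2}`. -/
def normF2 (S : QuadSystem κ) (Q : Matrix κ κ ℂ) : ℝ := ‖Q⁻¹ * S.F2 * (Q ⊗ₖ Q)‖

/-- The norm of `Q⁻¹ F0`. -/
def normF0 (S : QuadSystem κ) (Q : Matrix κ κ ℂ) : ℝ := euclNorm (Q⁻¹ *ᵥ S.F0)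

/-- The largest rescaling parameter `γ₀ = e ‖Q⁻¹ F2 Q^{⊗ 2}‖ / (δ(F1) ‖Q‖)`. -/
def gammaZero (S : QuadSystem κ) (Q : Matrix κ κ ℂ) : ℝ :=
  Real.exp 1 * S.normF2 Q / (realSpectralGap S.F1 * ‖Q‖)

/-- The number `R_{δ,υ}`, where `X` bounds the norm of the transformed solution. -/
def Rups (S : QuadSystem κ) (Q : Matrix κ κ ℂ) (X υ : ℝ) : ℝ :=
  2 * Real.exp 1 * √(X ^ 2 + υ ^ 2) * max (S.normF2 Q) (S.normF0 Q / υ ^ 2) /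
    realSpectralGap S.F1

/-- The optimal parameter `υ_*`. -/
def upsStar (S : QuadSystem κ) (Q : Matrix κ κ ℂ) : ℝ := √(S.normF0 Q / S.normF2 Q)

/-- The number `R_δ`. -/
def Rdelta (S : QuadSystem κ) (Q : Matrix κ κ ℂ) (X : ℝ) : ℝ :=
  2 * Real.exp 1 * S.normF2 Q * √(X ^ 2 + S.normF0 Q / S.normF2 Q) / realSpectralGap S.F1

end QuadSystem

end

/-!
Write `z = [γ x, γ υ]` for the solution of the embedded undriven system. Its tensor powers solve the
infinite Carleman system, so the errors `η_j = z^{⊗ j} - y^{[j]}` start at zero and solve the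
truncated system, with `z^{⊗ (k + 1)}` as the only source, at level `k`. In the coordinates
`P = Q⁻¹ ⊕ 1` the linear part is diagonal (`tensorMap_carlemanDiag`, `tensorMap_carlemanUp`).

With neutral modes, the decay rate of an entry of `η_j` is not proportional to `j`: it is only
`n δ`, where `n` is the number of decaying letters of its word, while the forcing has `j` summands.
Estimating these separately would produce a factorial. What saves the estimate is that a neutral
mode comes from a conserved quantity, so that its row of `F2` has no symmetric part
(`diagonalized_row_of_mem_span`); since `η_{j+1}` is symmetric
(`isSymmTensor_of_hasDerivWithinAt`), the forcing at a neutral letter vanishes (`contract_eq_zero`),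
and `n` decaying letters feel exactly `n` forcing terms. To exploit this, the tensors are estimated
sector by sector, a sector being the set of words with prescribed classes of letters (decaying,
neutral, extra label): an energy estimate in each sector (`sectorSq_le_of_hasDerivWithinAt`) has a
constant independent of `n`. The sector bounds propagate from level `j + 1` to level `j` as
multiples of a product of weights, one for each letter (`sectorSq_contract_le`,
`sectorSq_truncation_error_le`), and products of weights have an exact sum over the sectors
(`sum_norm_sq_discardExtra_error_le`).

Returning to the original coordinates costs `‖Q‖ ^ j`, which the choice of `γ₀` balances
(`euclNorm_truncation_error_le_Rups`). With the weights `γ √(X² + υ²)` and `γ X` for decaying and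
neutral letters, each level but the top one costs a factor `2` more than the stable case, and so does
each of the `j` letters at the end; this, together with `(k + 1) e ^ j ≤ j e ^ (k + 1)`, accounts
for the constant `2 e` in `R_{δ,υ}`. The remaining claims are uniqueness for a locally Lipschitz
field and the minimization of an explicit function.
-/

noncomputable section

/-! ### Pure tensors and induced maps on tensor powers -/

/-- The pure tensor `u 0 ⊗ ⋯ ⊗ u (j - 1)`, with entries indexed by words of length `j`. -/
def pureTensor {κ : Type*} {j : ℕ} (u : Fin j → κ → ℂ) : (Fin j → κ) → ℂ :=
  fun α => ∏ i, u i (α i)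

/-- The tensor power `P^{⊗ j}` of a matrix, acting on tensors of order `j`. -/
def tensorMap {κ κ' : Type*} [Fintype κ] (P : Matrix κ' κ ℂ) (j : ℕ) :
    ((Fin j → κ) → ℂ) →ₗ[ℂ] ((Fin j → κ') → ℂ) :=
  Matrix.mulVecLin (Matrix.of fun α β => ∏ i, P (α i) (β i))

lemma tensorPow_eq_pureTensor {κ : Type*} (v : κ → ℂ) (j : ℕ) :
    tensorPow v j = pureTensor fun _ => v := rfl

/-- Linear maps on tensors that agree on pure tensors are equal. -/
lemma linearMap_ext_pureTensor {κ E : Type*} [Fintype κ] [DecidableEq κ] [AddCommMonoid E]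
    [Module ℂ E] {j : ℕ} {f g : ((Fin j → κ) → ℂ) →ₗ[ℂ] E}
    (h : ∀ u, f (pureTensor u) = g (pureTensor u)) : f = g := by
  refine LinearMap.pi_ext' fun α => LinearMap.ext_ring ?_
  have : (Pi.single α 1 : (Fin j → κ) → ℂ) = pureTensor fun i => Pi.single (α i) 1 := by
    ext β
    simp only [pureTensor, Pi.single_apply, Finset.prod_ite_zero, Finset.prod_const_one,
      Finset.mem_univ, true_implies, funext_iff]
  simpa [this] using h _

lemma tensorMap_pureTensor {κ κ' : Type*} [Fintype κ] (P : Matrix κ' κ ℂ) {j : ℕ}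
    (u : Fin j → κ → ℂ) : tensorMap P j (pureTensor u) = pureTensor fun i => P *ᵥ u i := by
  classical
  ext α
  simp only [tensorMap, pureTensor, Matrix.mulVecLin_apply, Matrix.mulVec, dotProduct,
    Matrix.of_apply, Finset.prod_univ_sum, ← Finset.prod_mul_distrib, Fintype.piFinset_univ]

lemma tensorMap_tensorPow {κ κ' : Type*} [Fintype κ] (P : Matrix κ' κ ℂ) (j : ℕ) (v : κ → ℂ) :
    tensorMap P j (tensorPow v j) = tensorPow (P *ᵥ v) j :=
  tensorMap_pureTensor P _

lemma tensorMap_tensorMap {κ : Type*} [Fintype κ] [DecidableEq κ] (P R : Matrix κ κ ℂ) (j : ℕ)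
    (y : (Fin j → κ) → ℂ) : tensorMap P j (tensorMap R j y) = tensorMap (P * R) j y := by
  suffices h : tensorMap P j ∘ₗ tensorMap R j = tensorMap (P * R) j from
    LinearMap.congr_fun h y
  refine linearMap_ext_pureTensor fun u => ?_
  simp [tensorMap_pureTensor]

lemma tensorMap_one {κ : Type*} [Fintype κ] [DecidableEq κ] (j : ℕ)
    (y : (Fin j → κ) → ℂ) : tensorMap (1 : Matrix κ κ ℂ) j y = y := by
  suffices h : tensorMap (1 : Matrix κ κ ℂ) j = LinearMap.id from LinearMap.congr_fun h y
  refine linearMap_ext_pureTensor fun u => ?_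
  simp [tensorMap_pureTensor]

lemma pureTensor_update {κ : Type*} {j : ℕ} (u : Fin j → κ → ℂ) (l : Fin j) (v : κ → ℂ)
    (α : Fin j → κ) :
    pureTensor (Function.update u l v) α = v (α l) * ∏ i ∈ Finset.univ.erase l, u i (α i) := by
  rw [pureTensor, ← Finset.mul_prod_erase _ _ (Finset.mem_univ l)]
  congr 1
  · simp
  · exact Finset.prod_congr rfl fun i hi => by simp [Finset.ne_of_mem_erase hi]

/-- The block-diagonal matrix `Q ⊕ 1` acts on the retained entries as `Q`. -/
lemma discardExtra_tensorMap {κ : Type*} [Fintype κ] [DecidableEq κ] (Q : Matrix κ κ ℂ) (j : ℕ)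
    (y : (Fin j → κ ⊕ Unit) → ℂ) :
    discardExtra (tensorMap (Matrix.fromBlocks Q 0 0 1) j y) =
      tensorMap Q j (discardExtra y) := by
  let D : ((Fin j → κ ⊕ Unit) → ℂ) →ₗ[ℂ] ((Fin j → κ) → ℂ) :=
    { toFun := discardExtra, map_add' := fun _ _ => rfl, map_smul' := fun _ _ => rfl }
  suffices h : D ∘ₗ tensorMap (Matrix.fromBlocks Q 0 0 1) j = tensorMap Q j ∘ₗ D from
    LinearMap.congr_fun h y
  refine linearMap_ext_pureTensor fun u => ?_
  have hD : ∀ w : Fin j → κ ⊕ Unit → ℂ,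
      D (pureTensor w) = pureTensor fun i => w i ∘ Sum.inl := fun _ => rfl
  simp only [LinearMap.comp_apply, tensorMap_pureTensor, hD]
  congr 1
  ext i a
  simp [Matrix.fromBlocks_mulVec]

/-- A matrix acting on one more letter multiplies the Euclidean norm by at most its norm. -/
lemma sum_norm_sq_tensorMap_le {κ : Type*} [Fintype κ] [DecidableEq κ] (Q : Matrix κ κ ℂ) (j : ℕ)
    (y : (Fin j → κ) → ℂ) :
    ∑ α, ‖tensorMap Q j y α‖ ^ 2 ≤ (‖Q‖ ^ 2) ^ j * ∑ α, ‖y α‖ ^ 2 := by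
  induction j with
  | zero =>
    have : tensorMap Q 0 y = y := by
      ext α
      simp [tensorMap, Matrix.mulVec, dotProduct, Subsingleton.elim _ α]
    rw [this]
    simp
  | succ j ih =>
    have hcons : ∀ f : (Fin (j + 1) → κ) → ℝ,
        ∑ α, f α = ∑ β : Fin j → κ, ∑ a, f (Fin.cons a β) := fun f => by
      rw [← (Fin.consEquiv fun _ => κ).sum_comp, Fintype.sum_prod_type, Finset.sum_comm]
      rfl
    have hmap : ∀ a (β : Fin j → κ), tensorMap Q (j + 1) y (Fin.cons a β) =
        (Q *ᵥ fun b => tensorMap Q j (fun β' => y (Fin.cons b β')) β) a := fun a β => by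
      simp only [tensorMap, Matrix.mulVecLin_apply, Matrix.mulVec, dotProduct, Matrix.of_apply]
      rw [← (Fin.consEquiv fun _ => κ).sum_comp, Fintype.sum_prod_type]
      refine Finset.sum_congr rfl fun b _ => ?_
      rw [Finset.mul_sum]
      refine Finset.sum_congr rfl fun β' _ => ?_
      simp [Fin.prod_univ_succ, Fin.consEquiv, mul_assoc]
    have hQ : ∀ v : κ → ℂ, ∑ a, ‖(Q *ᵥ v) a‖ ^ 2 ≤ ‖Q‖ ^ 2 * ∑ a, ‖v a‖ ^ 2 := fun v => by
      have h := Q.l2_opNorm_mulVec (WithLp.toLp 2 v)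
      have h2 := pow_le_pow_left₀ (norm_nonneg _) h 2
      rwa [mul_pow, EuclideanSpace.norm_sq_eq, EuclideanSpace.norm_sq_eq] at h2
    rw [hcons, hcons]
    calc ∑ β : Fin j → κ, ∑ a, ‖tensorMap Q (j + 1) y (Fin.cons a β)‖ ^ 2
        ≤ ∑ β : Fin j → κ, ‖Q‖ ^ 2 *
            ∑ b, ‖tensorMap Q j (fun β' => y (Fin.cons b β')) β‖ ^ 2 :=
          Finset.sum_le_sum fun β _ => by simpa only [hmap] using hQ _
      _ = ‖Q‖ ^ 2 * ∑ b, ∑ β, ‖tensorMap Q j (fun β' => y (Fin.cons b β')) β‖ ^ 2 := by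
          rw [← Finset.mul_sum, Finset.sum_comm]
      _ ≤ ‖Q‖ ^ 2 * ∑ b, (‖Q‖ ^ 2) ^ j * ∑ β : Fin j → κ, ‖y (Fin.cons b β)‖ ^ 2 := by
          gcongr
          exact ih _
      _ = _ := by
          rw [← Finset.mul_sum, Finset.sum_comm, pow_succ]
          ring

/-! ### The Carleman blocks on pure tensors -/

namespace QuadSystem

variable {κ : Type*} [Fintype κ]

/-- The summand number `l` of the Carleman block `A_{j,j+1}`: the letters number `l` and `l + 1` are
contracted by `F2`. -/
def contract (S : QuadSystem κ) {j : ℕ} (l : Fin j) (y : (Fin (j + 1) → κ) → ℂ) :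
    (Fin j → κ) → ℂ :=
  fun α => ∑ a, ∑ b, S.F2 (α l) (a, b) * y (l.succ.insertNth b (Function.update α l a))

lemma carlemanUp_apply (S : QuadSystem κ) {j : ℕ} (y : (Fin (j + 1) → κ) → ℂ) (α : Fin j → κ) :
    S.carlemanUp y α = ∑ l, S.contract l y α := rfl

/-- The quadratic part of the system, as a bilinear map. -/
def bilin (S : QuadSystem κ) (u v : κ → ℂ) : κ → ℂ := S.F2 *ᵥ fun s : κ × κ => u s.1 * v s.2

lemma contract_pureTensor (S : QuadSystem κ) {j : ℕ} (l : Fin j) (u : Fin (j + 1) → κ → ℂ) :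
    S.contract l (pureTensor u) =
      pureTensor (Function.update (fun i => u (l.succ.succAbove i)) l
        (S.bilin (u l.castSucc) (u l.succ))) := by
  ext α
  rw [pureTensor_update]
  simp only [contract, bilin, Matrix.mulVec, dotProduct, Fintype.sum_prod_type, Finset.sum_mul]
  refine Finset.sum_congr rfl fun a _ => Finset.sum_congr rfl fun b _ => ?_
  rw [pureTensor, Fin.prod_univ_succAbove _ l.succ]
  simp only [Fin.insertNth_apply_same, Fin.insertNth_apply_succAbove]
  rw [← Finset.mul_prod_erase _ _ (Finset.mem_univ l)]
  have : ∏ i ∈ Finset.univ.erase l, u (l.succ.succAbove i) (Function.update α l a i) =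
      ∏ i ∈ Finset.univ.erase l, u (l.succ.succAbove i) (α i) :=
    Finset.prod_congr rfl fun i hi => by simp [Finset.ne_of_mem_erase hi]
  rw [this, Fin.succAbove_succ_self]
  simp only [Function.update_self]
  ring

lemma carlemanDiag_pureTensor (S : QuadSystem κ) {j : ℕ} (u : Fin j → κ → ℂ) (α : Fin j → κ) :
    S.carlemanDiag (pureTensor u) α =
      ∑ l, pureTensor (Function.update u l (S.F1 *ᵥ u l)) α := by
  refine Finset.sum_congr rfl fun l _ => ?_
  rw [pureTensor_update]
  simp only [Matrix.mulVec, dotProduct, Finset.sum_mul]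
  refine Finset.sum_congr rfl fun a _ => ?_
  rw [pureTensor, ← Finset.mul_prod_erase _ _ (Finset.mem_univ l)]
  have : ∏ i ∈ Finset.univ.erase l, u i (Function.update α l a i) =
      ∏ i ∈ Finset.univ.erase l, u i (α i) :=
    Finset.prod_congr rfl fun i hi => by simp [Finset.ne_of_mem_erase hi]
  rw [this]
  simp only [Function.update_self]
  ring

/-- `carlemanDiag` as a linear map. -/
def carlemanDiagLin (S : QuadSystem κ) (j : ℕ) : ((Fin j → κ) → ℂ) →ₗ[ℂ] ((Fin j → κ) → ℂ) where
  toFun := S.carlemanDiag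
  map_add' y z := by
    ext α
    simp [carlemanDiag, mul_add, Finset.sum_add_distrib]
  map_smul' r y := by
    ext α
    simp [carlemanDiag, Finset.mul_sum, mul_left_comm]

/-- `contract` as a linear map. -/
def contractLin (S : QuadSystem κ) {j : ℕ} (l : Fin j) :
    ((Fin (j + 1) → κ) → ℂ) →ₗ[ℂ] ((Fin j → κ) → ℂ) where
  toFun := S.contract l
  map_add' y z := by
    ext α
    simp [contract, mul_add, Finset.sum_add_distrib]
  map_smul' r y := by
    ext α
    simp [contract, Finset.mul_sum, mul_left_comm]

/-- `carlemanUp` as a linear map. -/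
def carlemanUpLin (S : QuadSystem κ) (j : ℕ) :
    ((Fin (j + 1) → κ) → ℂ) →ₗ[ℂ] ((Fin j → κ) → ℂ) :=
  ∑ l, S.contractLin l

lemma carlemanUpLin_apply (S : QuadSystem κ) {j : ℕ} (y : (Fin (j + 1) → κ) → ℂ) :
    S.carlemanUpLin j y = S.carlemanUp y := by
  ext α
  simp [carlemanUpLin, contractLin, carlemanUp_apply]

/-- A linear change of variables which conjugates `F1` conjugates the diagonal Carleman blocks. -/
lemma tensorMap_carlemanDiag [DecidableEq κ] {S S' : QuadSystem κ} {P : Matrix κ κ ℂ}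
    (h : P * S.F1 = S'.F1 * P) {j : ℕ} (y : (Fin j → κ) → ℂ) :
    tensorMap P j (S.carlemanDiag y) = S'.carlemanDiag (tensorMap P j y) := by
  suffices h : tensorMap P j ∘ₗ S.carlemanDiagLin j = S'.carlemanDiagLin j ∘ₗ tensorMap P j from
    LinearMap.congr_fun h y
  refine linearMap_ext_pureTensor fun u => ?_
  change tensorMap P j (S.carlemanDiag (pureTensor u)) =
    S'.carlemanDiag (tensorMap P j (pureTensor u))
  have h1 : S.carlemanDiag (pureTensor u) =
      ∑ l, pureTensor (Function.update u l (S.F1 *ᵥ u l)) := by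
    ext α
    simp [carlemanDiag_pureTensor]
  rw [h1, map_sum, tensorMap_pureTensor]
  ext α
  rw [carlemanDiag_pureTensor, Finset.sum_apply]
  refine Finset.sum_congr rfl fun l _ => ?_
  rw [tensorMap_pureTensor]
  congr 2
  ext1 i
  rcases eq_or_ne i l with rfl | hi
  · simp [Matrix.mulVec_mulVec, h]
  · simp [hi]

/-- A linear change of variables which conjugates `F2` conjugates the off-diagonal Carleman
blocks. -/
lemma tensorMap_carlemanUp [DecidableEq κ] {S S' : QuadSystem κ} {P : Matrix κ κ ℂ}
    (h : ∀ u v, P *ᵥ S.bilin u v = S'.bilin (P *ᵥ u) (P *ᵥ v)) {j : ℕ}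
    (y : (Fin (j + 1) → κ) → ℂ) :
    tensorMap P j (S.carlemanUp y) = S'.carlemanUp (tensorMap P (j + 1) y) := by
  simp only [← carlemanUpLin_apply, carlemanUpLin, LinearMap.sum_apply, map_sum]
  refine Finset.sum_congr rfl fun l _ => ?_
  suffices h : tensorMap P j ∘ₗ S.contractLin l = S'.contractLin l ∘ₗ tensorMap P (j + 1) from
    LinearMap.congr_fun h y
  refine linearMap_ext_pureTensor fun u => ?_
  change tensorMap P j (S.contract l (pureTensor u)) =
    S'.contract l (tensorMap P (j + 1) (pureTensor u))
  rw [contract_pureTensor, tensorMap_pureTensor, tensorMap_pureTensor, contract_pureTensor]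
  congr 1
  ext1 i
  rcases eq_or_ne i l with rfl | hi
  · simp [h]
  · simp [hi]

/-- The tensor powers of a solution of an undriven system solve its (infinite) Carleman system. -/
lemma hasDerivWithinAt_tensorPow (S : QuadSystem κ) (h0 : S.F0 = 0) {z : ℝ → κ → ℂ} {s : Set ℝ}
    {t : ℝ} (hz : HasDerivWithinAt z (S.field (z t)) s t) (j : ℕ) :
    HasDerivWithinAt (fun t => tensorPow (z t) j)
      (S.carlemanDiag (tensorPow (z t) j) + S.carlemanUp (tensorPow (z t) (j + 1))) s t := by
  rw [hasDerivWithinAt_pi] at hz ⊢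
  intro α
  have h := HasDerivWithinAt.fun_finsetProd (u := Finset.univ) (f := fun i t => z t (α i))
    (fun i _ => hz (α i))
  refine h.congr_deriv ?_
  rw [Pi.add_apply, carlemanUp_apply, tensorPow_eq_pureTensor, carlemanDiag_pureTensor,
    tensorPow_eq_pureTensor, ← Finset.sum_add_distrib]
  refine Finset.sum_congr rfl fun l _ => ?_
  rw [contract_pureTensor, pureTensor_update, pureTensor_update, ← add_mul, smul_eq_mul, mul_comm]
  simp [field, h0, bilin]

end QuadSystem

/-! ### Symmetric tensors -/

/-- A tensor is symmetric if its entries do not depend on the order of the letters. -/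
def IsSymmTensor {κ : Type*} {j : ℕ} (y : (Fin j → κ) → ℂ) : Prop :=
  ∀ (σ : Equiv.Perm (Fin j)) (α : Fin j → κ), y (α ∘ σ) = y α

lemma isSymmTensor_tensorPow {κ : Type*} (v : κ → ℂ) (j : ℕ) : IsSymmTensor (tensorPow v j) :=
  fun σ α => Equiv.prod_comp σ fun i => v (α i)

/-- In a symmetric tensor, the place of an inserted letter and the order of the other letters are
immaterial. -/
lemma IsSymmTensor.apply_insertNth {κ : Type*} {n : ℕ} {y : (Fin (n + 1) → κ) → ℂ}
    (hy : IsSymmTensor y) (p r : Fin (n + 1)) (b : κ) (β : Fin n → κ) (σ : Equiv.Perm (Fin n)) :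
    y (p.insertNth b (β ∘ σ)) = y (r.insertNth b β) := by
  rw [← hy ((finSuccEquiv' p).trans (σ.optionCongr.trans (finSuccEquiv' r).symm))
    (r.insertNth b β)]
  congr 1
  ext i
  refine Fin.succAboveCases p ?_ (fun k => ?_) i <;> simp

namespace QuadSystem

variable {κ : Type*} [Fintype κ]

lemma contract_comp_perm (S : QuadSystem κ) {j : ℕ} {y : (Fin (j + 1) → κ) → ℂ}
    (hy : IsSymmTensor y) (l : Fin j) (σ : Equiv.Perm (Fin j)) (α : Fin j → κ) :
    S.contract l y (α ∘ σ) = S.contract (σ l) y α := by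
  refine Finset.sum_congr rfl fun a _ => Finset.sum_congr rfl fun b _ => ?_
  have : Function.update (α ∘ σ) l a = Function.update α (σ l) a ∘ σ := by
    rw [Function.update_comp_equiv, Equiv.symm_apply_apply]
  rw [this, hy.apply_insertNth l.succ (σ l).succ]
  rfl

lemma isSymmTensor_carlemanUp (S : QuadSystem κ) {j : ℕ} {y : (Fin (j + 1) → κ) → ℂ}
    (hy : IsSymmTensor y) : IsSymmTensor (S.carlemanUp y) := fun σ α => by
  simp only [carlemanUp_apply, S.contract_comp_perm hy]
  exact Equiv.sum_comp σ fun l => S.contract l y α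

/-- A row of `F2` with vanishing symmetric part does not contribute to the contraction of a
symmetric tensor. -/
lemma contract_eq_zero (S : QuadSystem κ) {j : ℕ} {y : (Fin (j + 1) → κ) → ℂ}
    (hy : IsSymmTensor y) (l : Fin j) (α : Fin j → κ)
    (hα : ∀ a b, S.F2 (α l) (a, b) + S.F2 (α l) (b, a) = 0) : S.contract l y α = 0 := by
  have hswap : ∀ a b, y (l.succ.insertNth b (Function.update α l a)) =
      y (l.succ.insertNth a (Function.update α l b)) := fun a b => by
    rw [← hy (Equiv.swap l.castSucc l.succ) (l.succ.insertNth b (Function.update α l a))]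
    have happ := fun x (β : Fin j → κ) => Fin.insertNth_apply_succAbove (α := fun _ => κ) l.succ x β
    have hl := fun x β => happ x β l
    simp only [Fin.succAbove_succ_self] at hl
    congr 1
    ext i
    refine Fin.succAboveCases l.succ ?_ (fun k => ?_) i
    · rw [Function.comp_apply, Equiv.swap_apply_right, hl, Fin.insertNth_apply_same,
        Function.update_self]
    · rcases eq_or_ne k l with rfl | hk
      · rw [happ, Fin.succAbove_succ_self, Function.comp_apply, Equiv.swap_apply_left,
          Fin.insertNth_apply_same, Function.update_self]
      · have h1 : l.succ.succAbove k ≠ l.castSucc := by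
          rw [← Fin.succAbove_succ_self]
          exact fun h => hk (Fin.succAbove_right_injective h)
        rw [Function.comp_apply, Equiv.swap_apply_of_ne_of_ne h1 (Fin.succAbove_ne _ _), happ, happ,
          Function.update_of_ne hk, Function.update_of_ne hk]
  have h2 : S.contract l y α + S.contract l y α = 0 := by
    conv_lhs => enter [2]; rw [contract, Finset.sum_comm]
    rw [contract]
    simp only [← Finset.sum_add_distrib]
    refine Finset.sum_eq_zero fun a _ => Finset.sum_eq_zero fun b _ => ?_
    rw [hswap b a, ← add_mul, hα, zero_mul]
  exact self_eq_neg.mp (eq_neg_of_add_eq_zero_left h2)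

lemma carlemanDiag_diagonal [DecidableEq κ] {S : QuadSystem κ} {μ : κ → ℂ}
    (hS : S.F1 = Matrix.diagonal μ) {j : ℕ} (y : (Fin j → κ) → ℂ) (α : Fin j → κ) :
    S.carlemanDiag y α = (∑ i, μ (α i)) * y α := by
  simp only [carlemanDiag, hS, Matrix.diagonal_apply, ite_mul, zero_mul, Finset.sum_ite_eq,
    Finset.mem_univ, if_true, Function.update_eq_self, Finset.sum_mul]

end QuadSystem

/-! ### Differential inequalities -/

/-- A form of Grönwall's inequality: an upper barrier `M` is not crossed. -/
lemma le_of_hasDerivWithinAt_le {φ φ' : ℝ → ℝ} {a M : ℝ}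
    (hd : ∀ t, 0 ≤ t → HasDerivWithinAt φ (φ' t) (Set.Ici 0) t)
    (hle : ∀ t, 0 ≤ t → φ' t ≤ a * (M - φ t)) (h0 : φ 0 ≤ M) (t : ℝ) (ht : 0 ≤ t) :
    φ t ≤ M := by
  have hψ : ∀ t, 0 ≤ t → HasDerivWithinAt (fun t => Real.exp (a * t) * (φ t - M))
      (Real.exp (a * t) * (φ' t - a * (M - φ t))) (Set.Ici 0) t := fun t ht => by
    have h1 : HasDerivWithinAt (fun t => Real.exp (a * t)) (Real.exp (a * t) * (a * 1))
        (Set.Ici 0) t := ((hasDerivAt_id t).const_mul a).exp.hasDerivWithinAt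
    exact (h1.mul ((hd t ht).sub_const M)).congr_deriv (by ring)
  have hanti : AntitoneOn (fun t => Real.exp (a * t) * (φ t - M)) (Set.Ici 0) := by
    refine antitoneOn_of_hasDerivWithinAt_nonpos (convex_Ici 0)
      (f' := fun t => Real.exp (a * t) * (φ' t - a * (M - φ t)))
      (fun t ht => (hψ t ht).continuousWithinAt) (fun t ht => ?_) (fun t ht => ?_)
    · exact (hψ t (interior_subset ht)).mono interior_subset
    · exact mul_nonpos_of_nonneg_of_nonpos (Real.exp_pos _).le
        (sub_nonpos.2 (hle t (interior_subset ht)))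
  have h := hanti Set.self_mem_Ici ht ht
  simp only [mul_zero, Real.exp_zero, one_mul] at h
  nlinarith [Real.exp_pos (a * t)]

/-- Along a scalar equation `f' = μ f + h`, the derivative of `‖f‖ ^ 2`. -/
lemma hasDerivWithinAt_norm_sq {f : ℝ → ℂ} {μ h : ℂ} {s : Set ℝ} {t : ℝ}
    (hf : HasDerivWithinAt f (μ * f t + h) s t) :
    HasDerivWithinAt (fun t => ‖f t‖ ^ 2) (2 * (μ.re * ‖f t‖ ^ 2 + inner ℝ (f t) h)) s t := by
  refine hf.norm_sq.congr_deriv ?_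
  rw [inner_add_right]
  congr 2
  rw [Complex.inner, ← Complex.normSq_eq_norm_sq, Complex.normSq_apply]
  simp only [Complex.mul_re, Complex.mul_im, Complex.conj_re, Complex.conj_im]
  ring

namespace QuadSystem

variable {κ : Type*} [Fintype κ] [DecidableEq κ]

/-- For a diagonal linear part, the solution of a Carleman block started at zero is symmetric if the
next block is. -/
lemma isSymmTensor_of_hasDerivWithinAt {S : QuadSystem κ} {μ : κ → ℂ}
    (hS : S.F1 = Matrix.diagonal μ) {j : ℕ} {f : ℝ → (Fin j → κ) → ℂ}
    {g : ℝ → (Fin (j + 1) → κ) → ℂ}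
    (hf : ∀ t, 0 ≤ t → HasDerivWithinAt f (S.carlemanDiag (f t) + S.carlemanUp (g t))
      (Set.Ici 0) t)
    (hf0 : f 0 = 0) (hg : ∀ t, 0 ≤ t → IsSymmTensor (g t)) (t : ℝ) (ht : 0 ≤ t) :
    IsSymmTensor (f t) := by
  intro σ α
  have hd : ∀ t, 0 ≤ t → HasDerivWithinAt (fun t => f t (α ∘ σ) - f t α)
      ((∑ i, μ (α i)) * (f t (α ∘ σ) - f t α) + 0) (Set.Ici 0) t := fun t ht => by
    have h := hasDerivWithinAt_pi.1 (hf t ht)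
    refine ((h (α ∘ σ)).sub (h α)).congr_deriv ?_
    simp only [Pi.add_apply, carlemanDiag_diagonal hS,
      S.isSymmTensor_carlemanUp (hg t ht) σ α]
    have : ∑ i, μ ((α ∘ σ) i) = ∑ i, μ (α i) := Equiv.sum_comp σ fun i => μ (α i)
    rw [this]
    ring
  have h := le_of_hasDerivWithinAt_le (M := 0) (a := -2 * (∑ i, μ (α i)).re)
    (fun t ht => hasDerivWithinAt_norm_sq (hd t ht))
    (fun t ht => by simp only [inner_zero_right]; nlinarith) (by simp [hf0]) t ht
  exact sub_eq_zero.1 (norm_eq_zero.1 (pow_eq_zero_iff two_ne_zero |>.1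
    (le_antisymm h (sq_nonneg _))))

end QuadSystem

/-! ### Sectors of a tensor -/

/-- The squared Euclidean norm of the part of a tensor supported on words whose letters have the
prescribed classes `τ`, for a classification `c` of the letters. -/
def sectorSq {κ T : Type*} [Fintype κ] [DecidableEq T] (c : κ → T) {j : ℕ} (τ : Fin j → T)
    (y : (Fin j → κ) → ℂ) : ℝ :=
  ∑ α with c ∘ α = τ, ‖y α‖ ^ 2

section Sector

variable {κ T : Type*} [Fintype κ] [DecidableEq T] (c : κ → T)

lemma sectorSq_nonneg {j : ℕ} (τ : Fin j → T) (y : (Fin j → κ) → ℂ) : 0 ≤ sectorSq c τ y :=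
  Finset.sum_nonneg fun _ _ => sq_nonneg _

/-- Splitting off the letter at the place `p`. -/
lemma sectorSq_insertNth {n : ℕ} (p : Fin (n + 1)) (s : T) (ρ : Fin n → T)
    (y : (Fin (n + 1) → κ) → ℂ) :
    sectorSq c (p.insertNth s ρ) y =
      ∑ a, if c a = s then sectorSq c ρ (fun β => y (p.insertNth a β)) else 0 := by
  rw [sectorSq, Finset.sum_filter, ← (Fin.insertNthEquiv (fun _ => κ) p).sum_comp,
    Fintype.sum_prod_type]
  refine Finset.sum_congr rfl fun a _ => ?_
  have hiff : ∀ β : Fin n → κ, c ∘ (p.insertNth a β : Fin (n + 1) → κ) = p.insertNth s ρ ↔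
      c a = s ∧ c ∘ β = ρ := fun β => by
    rw [funext_iff, p.forall_iff_succAbove]
    simp [funext_iff]
  have happ : ∀ β : Fin n → κ, Fin.insertNthEquiv (fun _ => κ) p (a, β) = p.insertNth a β :=
    fun _ => rfl
  simp only [happ, hiff, sectorSq, Finset.sum_filter, ite_and]
  split_ifs with h
  · rfl
  · exact Finset.sum_const_zero

lemma sectorSq_tensorPow {j : ℕ} (τ : Fin j → T) (z : κ → ℂ) :
    sectorSq c τ (tensorPow z j) = ∏ i, ∑ a with c a = τ i, ‖z a‖ ^ 2 := by
  classical
  rw [Finset.prod_univ_sum, sectorSq]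
  refine Finset.sum_congr ?_ fun α _ => ?_
  · ext α
    simp [funext_iff]
  · rw [tensorPow, norm_prod, Finset.prod_pow]

/-- The energy estimate for one Carleman block: in a sector with `n` letters of the decaying class
`s₀`, the decay rate is at least `n δ`, and at most `n` summands of the forcing term are nonzero. -/
lemma sectorSq_le_of_hasDerivWithinAt [DecidableEq κ] {S : QuadSystem κ} {μ : κ → ℂ}
    (hS : S.F1 = Matrix.diagonal μ) {s₀ : T} {δ : ℝ} (hδ : 0 < δ)
    (hdecay : ∀ r, c r = s₀ → (μ r).re ≤ -δ) (hneutral : ∀ r, c r ≠ s₀ → (μ r).re ≤ 0)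
    (hanti : ∀ r, c r ≠ s₀ → ∀ a b, S.F2 r (a, b) + S.F2 r (b, a) = 0)
    {j : ℕ} {f : ℝ → (Fin j → κ) → ℂ} {g : ℝ → (Fin (j + 1) → κ) → ℂ}
    (hf : ∀ t, 0 ≤ t → HasDerivWithinAt f (S.carlemanDiag (f t) + S.carlemanUp (g t))
      (Set.Ici 0) t)
    (hf0 : f 0 = 0) (hg : ∀ t, 0 ≤ t → IsSymmTensor (g t)) (τ : Fin j → T) {H : ℝ}
    (hH : ∀ t, 0 ≤ t → ∀ l, τ l = s₀ → sectorSq c τ (S.contract l (g t)) ≤ H ^ 2)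
    (t : ℝ) (ht : 0 ≤ t) : sectorSq c τ (f t) ≤ (H / δ) ^ 2 := by
  set L : Finset (Fin j) := {l | τ l = s₀} with hL
  have hd : ∀ t, 0 ≤ t → HasDerivWithinAt (fun t => sectorSq c τ (f t))
      (∑ α with c ∘ α = τ, 2 * ((∑ i, μ (α i)).re * ‖f t α‖ ^ 2 +
        inner ℝ (f t α) (S.carlemanUp (g t) α))) (Set.Ici 0) t := fun t ht => by
    refine HasDerivWithinAt.fun_sum fun α _ => hasDerivWithinAt_norm_sq ?_
    refine (hasDerivWithinAt_pi.1 (hf t ht) α).congr_deriv ?_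
    rw [Pi.add_apply, QuadSystem.carlemanDiag_diagonal hS]
  refine le_of_hasDerivWithinAt_le (a := L.card * δ) hd (fun t ht => ?_) ?_ t ht
  · have hpt : ∀ α, c ∘ α = τ → 2 * ((∑ i, μ (α i)).re * ‖f t α‖ ^ 2 +
        inner ℝ (f t α) (S.carlemanUp (g t) α)) ≤
        ∑ l ∈ L, (-δ * ‖f t α‖ ^ 2 + ‖S.contract l (g t) α‖ ^ 2 / δ) := fun α hα => by
      have hcl : ∀ l, c (α l) = τ l := fun l => congrFun hα l
      have hre : (∑ i, μ (α i)).re ≤ ∑ l ∈ L, -δ := by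
        rw [Complex.re_sum, hL, Finset.sum_filter]
        refine Finset.sum_le_sum fun l _ => ?_
        split_ifs with h
        · exact hdecay _ ((hcl l).trans h)
        · exact hneutral _ fun h' => h ((hcl l).symm.trans h')
      have hup : S.carlemanUp (g t) α = ∑ l ∈ L, S.contract l (g t) α := by
        rw [QuadSystem.carlemanUp_apply, hL, Finset.sum_filter]
        refine Finset.sum_congr rfl fun l _ => ?_
        split_ifs with h
        · rfl
        · exact S.contract_eq_zero (hg t ht) l α
            (hanti _ fun h' => h ((hcl l).symm.trans h'))
      -- each forcing term costs half of the decay of one letter: `2 ‖f‖ ‖h‖ ≤ δ ‖f‖² + ‖h‖² / δ`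
      rw [hup, inner_sum, mul_add, ← mul_assoc, Finset.mul_sum]
      calc _ ≤ (∑ l ∈ L, -δ) * 2 * ‖f t α‖ ^ 2 +
            ∑ l ∈ L, (δ * ‖f t α‖ ^ 2 + ‖S.contract l (g t) α‖ ^ 2 / δ) := by
            refine add_le_add ?_ (Finset.sum_le_sum fun l _ => ?_)
            · nlinarith [sq_nonneg ‖f t α‖]
            · have h1 := real_inner_le_norm (f t α) (S.contract l (g t) α)
              have h2 : δ * ‖f t α‖ ^ 2 + ‖S.contract l (g t) α‖ ^ 2 / δ -
                  2 * (‖f t α‖ * ‖S.contract l (g t) α‖) =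
                  (δ * ‖f t α‖ - ‖S.contract l (g t) α‖) ^ 2 / δ := by
                field_simp
                ring
              have h3 : 0 ≤ (δ * ‖f t α‖ - ‖S.contract l (g t) α‖) ^ 2 / δ := by positivity
              linarith
        _ = _ := by
            rw [mul_assoc, Finset.sum_mul, ← Finset.sum_add_distrib]
            exact Finset.sum_congr rfl fun l _ => by ring
    calc _ ≤ ∑ α with c ∘ α = τ,
          ∑ l ∈ L, (-δ * ‖f t α‖ ^ 2 + ‖S.contract l (g t) α‖ ^ 2 / δ) :=
          Finset.sum_le_sum fun α hα => hpt α (Finset.mem_filter.1 hα).2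
      _ = ∑ l ∈ L, (-δ * sectorSq c τ (f t) + sectorSq c τ (S.contract l (g t)) / δ) := by
          rw [Finset.sum_comm]
          refine Finset.sum_congr rfl fun l _ => ?_
          rw [Finset.sum_add_distrib, ← Finset.mul_sum, ← Finset.sum_div]
          rfl
      _ ≤ ∑ l ∈ L, (-δ * sectorSq c τ (f t) + H ^ 2 / δ) := by
          refine Finset.sum_le_sum fun l hl => ?_
          gcongr
          exact hH t ht l (by simpa [hL] using hl)
      _ = _ := by
          rw [Finset.sum_const, nsmul_eq_mul]
          field_simp
          ring
  · simp only [hf0, sectorSq, Pi.zero_apply, norm_zero]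
    simpa using sq_nonneg (H / δ)

/-- Contraction of a tensor whose sectors are bounded by products of weights `w`. The estimate for
`F2` is a weighted one, with weights `ω` that depend on the classes of the two contracted
letters. -/
lemma sectorSq_contract_le [Fintype T] (S : QuadSystem κ) {ω : T → T → ℝ} (hω : ∀ s s', 0 ≤ ω s s')
    {w : T → ℝ} {G : ℝ}
    (hF : ∀ v : κ × κ → ℂ, ∑ r, ‖(S.F2 *ᵥ v) r‖ ^ 2 ≤
      G * ∑ a, ∑ b, ω (c a) (c b) * ‖v (a, b)‖ ^ 2)
    (hωw : ∑ s, ∑ s', ω s s' * (w s ^ 2 * w s' ^ 2) ≤ G)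
    {n : ℕ} (l : Fin (n + 1)) {y : (Fin (n + 2) → κ) → ℂ} {K : ℝ}
    (hy : ∀ τ, sectorSq c τ y ≤ (K * ∏ i, w (τ i)) ^ 2) (τ : Fin (n + 1) → T) :
    sectorSq c τ (S.contract l y) ≤ (G * K * ∏ i, w (l.removeNth τ i)) ^ 2 := by
  set ρ := l.removeNth τ with hρ
  have hG : 0 ≤ G := le_trans (Finset.sum_nonneg fun s _ => Finset.sum_nonneg fun s' _ =>
    mul_nonneg (hω s s') (by positivity)) hωw
  let v : (Fin n → κ) → κ × κ → ℂ := fun β p => y (l.succ.insertNth p.2 (l.insertNth p.1 β))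
  have hcontract : ∀ r β, S.contract l y (l.insertNth r β) = (S.F2 *ᵥ v β) r := fun r β => by
    simp [QuadSystem.contract, Matrix.mulVec, dotProduct, Fintype.sum_prod_type, v]
  have h1 : sectorSq c τ (S.contract l y) ≤
      ∑ β with c ∘ β = ρ, ∑ r, ‖(S.F2 *ᵥ v β) r‖ ^ 2 := by
    rw [← Fin.insertNth_self_removeNth l τ, sectorSq_insertNth, Finset.sum_comm]
    refine Finset.sum_le_sum fun r _ => ?_
    simp only [hcontract]
    split_ifs
    · exact le_rfl
    · exact Finset.sum_nonneg fun _ _ => sq_nonneg _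
  have h2 : ∀ s s', sectorSq c (l.succ.insertNth s' (l.insertNth s ρ)) y =
      ∑ b, if c b = s' then ∑ a, if c a = s then
        sectorSq c ρ (fun β => v β (a, b)) else 0 else 0 := fun s s' => by
    simp only [sectorSq_insertNth, v]
  have h3 : ∑ β with c ∘ β = ρ, ∑ a, ∑ b, ω (c a) (c b) * ‖v β (a, b)‖ ^ 2 =
      ∑ s, ∑ s', ω s s' * sectorSq c (l.succ.insertNth s' (l.insertNth s ρ)) y := by
    have h4 : ∀ s, ∑ s', ω s s' * sectorSq c (l.succ.insertNth s' (l.insertNth s ρ)) y =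
        ∑ b, ∑ a, if c a = s then ω s (c b) * sectorSq c ρ (fun β => v β (a, b)) else 0 :=
      fun s => by
        simp only [h2, Finset.mul_sum]
        rw [Finset.sum_comm]
        refine Finset.sum_congr rfl fun b _ => ?_
        simp [Finset.mul_sum]
    simp only [h4]
    have h5 : ∑ s, ∑ b, ∑ a, (if c a = s then
        ω s (c b) * sectorSq c ρ (fun β => v β (a, b)) else 0) =
        ∑ b, ∑ a, ω (c a) (c b) * sectorSq c ρ (fun β => v β (a, b)) := by
      rw [Finset.sum_comm]
      refine Finset.sum_congr rfl fun b _ => ?_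
      rw [Finset.sum_comm]
      simp
    rw [h5, Finset.sum_comm,
      Finset.sum_comm (s := Finset.univ (α := κ)) (t := Finset.univ (α := κ))]
    refine Finset.sum_congr rfl fun a _ => ?_
    rw [Finset.sum_comm]
    simp only [sectorSq, Finset.mul_sum]
  have h6 : ∀ s s', sectorSq c (l.succ.insertNth s' (l.insertNth s ρ)) y ≤
      w s ^ 2 * w s' ^ 2 * (K * ∏ i, w (ρ i)) ^ 2 := fun s s' => by
    refine (hy _).trans_eq ?_
    rw [Fin.prod_univ_succAbove _ l.succ, Fin.insertNth_apply_same]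
    simp only [Fin.insertNth_apply_succAbove]
    rw [Fin.prod_univ_succAbove _ l, Fin.insertNth_apply_same]
    simp only [Fin.insertNth_apply_succAbove]
    ring
  calc sectorSq c τ (S.contract l y)
      ≤ ∑ β with c ∘ β = ρ, G * ∑ a, ∑ b, ω (c a) (c b) * ‖v β (a, b)‖ ^ 2 :=
        h1.trans (Finset.sum_le_sum fun β _ => hF _)
    _ = G * ∑ s, ∑ s', ω s s' * sectorSq c (l.succ.insertNth s' (l.insertNth s ρ)) y := by
        rw [← Finset.mul_sum, h3]
    _ ≤ G * ∑ s, ∑ s', ω s s' * (w s ^ 2 * w s' ^ 2 * (K * ∏ i, w (ρ i)) ^ 2) := by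
        gcongr with s _ s' _
        · exact hω s s'
        · exact h6 s s'
    _ = G * (∑ s, ∑ s', ω s s' * (w s ^ 2 * w s' ^ 2)) * (K * ∏ i, w (ρ i)) ^ 2 := by
        rw [mul_assoc, Finset.sum_mul]
        simp only [Finset.sum_mul, mul_assoc]
    _ ≤ G * G * (K * ∏ i, w (ρ i)) ^ 2 := by gcongr
    _ = _ := by ring

/-- Contraction of a tensor power. -/
lemma sectorSq_contract_tensorPow_le (S : QuadSystem κ) {w : T → ℝ} {z : κ → ℂ} {h : ℝ}
    (hz : ∀ s, ∑ a with c a = s, ‖z a‖ ^ 2 ≤ w s ^ 2)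
    (hzz : ∑ r, ‖S.bilin z z r‖ ^ 2 ≤ h ^ 2)
    {n : ℕ} (l : Fin (n + 1)) (τ : Fin (n + 1) → T) :
    sectorSq c τ (S.contract l (tensorPow z (n + 2))) ≤
      (h * ∏ i, w (l.removeNth τ i)) ^ 2 := by
  have hval : ∀ r (β : Fin n → κ), S.contract l (tensorPow z (n + 2)) (l.insertNth r β) =
      S.bilin z z r * tensorPow z n β := fun r β => by
    rw [tensorPow_eq_pureTensor, QuadSystem.contract_pureTensor, pureTensor,
      Fin.prod_univ_succAbove _ l]
    simp [tensorPow]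
  have hsec : sectorSq c (l.removeNth τ) (tensorPow z n) ≤
      (∏ i, w (l.removeNth τ i)) ^ 2 := by
    rw [sectorSq_tensorPow, ← Finset.prod_pow]
    exact Finset.prod_le_prod (fun i _ => Finset.sum_nonneg fun _ _ => sq_nonneg _)
      fun i _ => hz _
  conv_lhs => rw [← Fin.insertNth_self_removeNth l τ, sectorSq_insertNth]
  calc _ ≤ ∑ r, ‖S.bilin z z r‖ ^ 2 * sectorSq c (l.removeNth τ) (tensorPow z n) := by
        refine Finset.sum_le_sum fun r _ => ?_
        split_ifs
        · simp only [hval, sectorSq, norm_mul, mul_pow, Finset.mul_sum, le_refl]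
        · exact mul_nonneg (sq_nonneg _) (sectorSq_nonneg c _ _)
    _ ≤ h ^ 2 * (∏ i, w (l.removeNth τ i)) ^ 2 := by
        rw [← Finset.sum_mul]
        exact mul_le_mul hzz hsec (sectorSq_nonneg c _ _) (sq_nonneg _)
    _ = _ := by ring

end Sector

/-- The truncation error of the Carleman system of a diagonalized undriven system, sector by sector.
The source at the truncation level is a tensor power, whose contraction is bounded directly by `h`;
each lower level contributes a factor `G / (δ w(s₀))`. -/
theorem sectorSq_truncation_error_le {κ T : Type*} [Fintype κ] [DecidableEq κ] [Fintype T]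
    [DecidableEq T] (c : κ → T) {S : QuadSystem κ} {μ : κ → ℂ}
    (hS : S.F1 = Matrix.diagonal μ) {s₀ : T} {δ : ℝ} (hδ : 0 < δ)
    (hdecay : ∀ r, c r = s₀ → (μ r).re ≤ -δ) (hneutral : ∀ r, c r ≠ s₀ → (μ r).re ≤ 0)
    (hanti : ∀ r, c r ≠ s₀ → ∀ a b, S.F2 r (a, b) + S.F2 r (b, a) = 0)
    {ω : T → T → ℝ} (hω : ∀ s s', 0 ≤ ω s s') {w : T → ℝ} (hw : 0 < w s₀) {G h : ℝ}
    (hF : ∀ v : κ × κ → ℂ, ∑ r, ‖(S.F2 *ᵥ v) r‖ ^ 2 ≤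
      G * ∑ a, ∑ b, ω (c a) (c b) * ‖v (a, b)‖ ^ 2)
    (hωw : ∑ s, ∑ s', ω s s' * (w s ^ 2 * w s' ^ 2) ≤ G)
    {z : ℝ → κ → ℂ} (hz : ∀ t, 0 ≤ t → ∀ s, ∑ a with c a = s, ‖z t a‖ ^ 2 ≤ w s ^ 2)
    (hzz : ∀ t, 0 ≤ t → ∑ r, ‖S.bilin (z t) (z t) r‖ ^ 2 ≤ h ^ 2)
    {k : ℕ} {e : (j : ℕ) → ℝ → (Fin j → κ) → ℂ} (he0 : ∀ i < k, e (i + 1) 0 = 0)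
    (he : ∀ i < k, ∀ t, 0 ≤ t → HasDerivWithinAt (e (i + 1))
      (S.carlemanDiag (e (i + 1) t) +
        S.carlemanUp (if i + 1 < k then e (i + 2) t else tensorPow (z t) (i + 2)))
      (Set.Ici 0) t) (d i : ℕ) (hi : i + 1 + d = k) (t : ℝ) (ht : 0 ≤ t) :
    IsSymmTensor (e (i + 1) t) ∧ ∀ τ, sectorSq c τ (e (i + 1) t) ≤
      ((G / (δ * w s₀)) ^ d * (h / (δ * w s₀)) * ∏ l, w (τ l)) ^ 2 := by
  have hprod : ∀ {n : ℕ} (τ : Fin (n + 1) → T) (l : Fin (n + 1)), τ l = s₀ →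
      ∏ i, w (τ i) = w s₀ * ∏ i, w (l.removeNth τ i) := fun τ l hl => by
    rw [Fin.prod_univ_succAbove _ l, hl]
    rfl
  induction d generalizing i t with
  | zero =>
    have hi' : i < k := by omega
    have hd := he i hi'
    simp only [if_neg (show ¬ i + 1 < k by omega)] at hd
    have hsymm : ∀ t, 0 ≤ t → IsSymmTensor (tensorPow (z t) (i + 2)) :=
      fun t _ => isSymmTensor_tensorPow _ _
    refine ⟨QuadSystem.isSymmTensor_of_hasDerivWithinAt hS hd (he0 i hi') hsymm t ht,
      fun τ => ?_⟩
    refine (sectorSq_le_of_hasDerivWithinAt c hS hδ hdecay hneutral hanti hd (he0 i hi') hsymm τ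
      (H := h / w s₀ * ∏ l, w (τ l)) (fun t ht l hl => ?_) t ht).trans_eq ?_
    · refine (sectorSq_contract_tensorPow_le c S (hz t ht) (hzz t ht) l τ).trans_eq ?_
      rw [hprod τ l hl]
      field_simp
    · field_simp
  | succ d ih =>
    have hi' : i < k := by omega
    have hd := he i hi'
    simp only [if_pos (show i + 1 < k by omega)] at hd
    have hsymm : ∀ t, 0 ≤ t → IsSymmTensor (e (i + 2) t) :=
      fun t ht => (ih (i + 1) (by omega) t ht).1
    refine ⟨QuadSystem.isSymmTensor_of_hasDerivWithinAt hS hd (he0 i hi') hsymm t ht,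
      fun τ => ?_⟩
    refine (sectorSq_le_of_hasDerivWithinAt c hS hδ hdecay hneutral hanti hd (he0 i hi') hsymm τ
      (H := G * ((G / (δ * w s₀)) ^ d * (h / (δ * w s₀))) / w s₀ * ∏ l, w (τ l))
      (fun t ht l hl => ?_) t ht).trans_eq ?_
    · refine (sectorSq_contract_le c S hω hF hωw l
        (ih (i + 1) (by omega) t ht).2 τ).trans_eq ?_
      rw [hprod τ l hl]
      field_simp
    · rw [pow_succ _ d]
      generalize (G / (δ * w s₀)) ^ d = D
      field_simp

/-! ### The embedded system -/

lemma euclNorm_sq {κ : Type*} [Fintype κ] (v : κ → ℂ) : euclNorm v ^ 2 = ∑ i, ‖v i‖ ^ 2 := by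
  rw [euclNorm, EuclideanSpace.norm_sq_eq]

lemma euclNorm_nonneg {κ : Type*} [Fintype κ] (v : κ → ℂ) : 0 ≤ euclNorm v := norm_nonneg _

lemma euclNorm_add_le {κ : Type*} [Fintype κ] (v w : κ → ℂ) :
    euclNorm (v + w) ≤ euclNorm v + euclNorm w :=
  norm_add_le (WithLp.toLp 2 v) (WithLp.toLp 2 w)

lemma euclNorm_smul {κ : Type*} [Fintype κ] (r : ℂ) (v : κ → ℂ) :
    euclNorm (r • v) = ‖r‖ * euclNorm v :=
  norm_smul r (WithLp.toLp 2 v)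

lemma euclNorm_mulVec_le {κ κ' : Type*} [Fintype κ] [Fintype κ'] [DecidableEq κ']
    (A : Matrix κ κ' ℂ) (v : κ' → ℂ) : euclNorm (A *ᵥ v) ≤ ‖A‖ * euclNorm v :=
  A.l2_opNorm_mulVec (WithLp.toLp 2 v)

lemma euclNorm_tensor {κ : Type*} [Fintype κ] (u : κ → ℂ) :
    euclNorm (fun s : κ × κ => u s.1 * u s.2) = euclNorm u ^ 2 := by
  refine (pow_left_inj₀ (euclNorm_nonneg _) (sq_nonneg _) two_ne_zero).1 ?_
  rw [euclNorm_sq, euclNorm_sq, Fintype.sum_prod_type, sq (∑ i, ‖u i‖ ^ 2),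
    Finset.sum_mul_sum]
  simp [mul_pow]

namespace QuadSystem

variable {κ : Type*} [Fintype κ]

lemma absorb_F2_mulVec (R : QuadSystem κ) (c : ℝ) (v : (κ ⊕ Unit) × (κ ⊕ Unit) → ℂ) :
    (R.absorb c).F2 *ᵥ v = Sum.elim (R.F2 *ᵥ (fun s => v (Sum.inl s.1, Sum.inl s.2)) +
      (v (Sum.inr (), Sum.inr ()) / (c : ℂ) ^ 2) • R.F0) 0 := by
  ext r
  rcases r with i | _
  · simp only [Matrix.mulVec, dotProduct, Fintype.sum_prod_type, Fintype.sum_sum_type, absorb,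
      Matrix.of_apply, Sum.elim_inl, Pi.add_apply, Pi.smul_apply, smul_eq_mul]
    simp
    ring
  · simp [Matrix.mulVec, dotProduct, absorb]

/-- The quadratic part of the embedded system is bounded by the norms of its two blocks. -/
lemma sum_norm_sq_absorb_F2_le [DecidableEq κ] (R : QuadSystem κ) (c : ℝ)
    (v : (κ ⊕ Unit) × (κ ⊕ Unit) → ℂ) :
    ∑ r, ‖((R.absorb c).F2 *ᵥ v) r‖ ^ 2 ≤
      (‖R.F2‖ * euclNorm (fun s : κ × κ => v (Sum.inl s.1, Sum.inl s.2)) +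
        euclNorm R.F0 / c ^ 2 * ‖v (Sum.inr (), Sum.inr ())‖) ^ 2 := by
  rw [absorb_F2_mulVec, Fintype.sum_sum_type]
  simp only [Sum.elim_inl, Sum.elim_inr, Pi.zero_apply, norm_zero, ne_eq, OfNat.ofNat_ne_zero,
    not_false_eq_true, zero_pow, Finset.sum_const_zero, add_zero]
  rw [← euclNorm_sq]
  refine pow_le_pow_left₀ (euclNorm_nonneg _) ((euclNorm_add_le _ _).trans ?_) 2
  refine add_le_add (euclNorm_mulVec_le _ _) (le_of_eq ?_)
  rw [euclNorm_smul, norm_div, norm_pow, Complex.norm_real, Real.norm_eq_abs, sq_abs]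
  ring

/-- The retained part of the truncation error of an embedded system whose linear part is
diagonal. The letters are classified into decaying ones (`some true`), neutral ones
(`some false`), and the extra label (`none`), with weights `A`, `X` and `|c|`. -/
theorem sum_norm_sq_discardExtra_error_le [DecidableEq κ] {R : QuadSystem κ} {Λ : κ → ℂ}
    (hR : R.F1 = Matrix.diagonal Λ) {δ : ℝ} (hδ : 0 < δ)
    (hspec : ∀ i, (Λ i).re ≤ -δ ∨
      Λ i = 0 ∧ R.F0 i = 0 ∧ ∀ a b, R.F2 i (a, b) + R.F2 i (b, a) = 0)
    {A X c f2 f0 : ℝ} (hA : 0 < A) (hXA : X ≤ A) (hc : c ≠ 0) (hf2 : ‖R.F2‖ ≤ f2)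
    (hf0 : euclNorm R.F0 / c ^ 2 ≤ f0) {x : ℝ → κ → ℂ}
    (hX : ∀ t, 0 ≤ t → euclNorm (x t) ≤ X)
    {k : ℕ} {e : (j : ℕ) → ℝ → (Fin j → κ ⊕ Unit) → ℂ} (he0 : ∀ i < k, e (i + 1) 0 = 0)
    (he : ∀ i < k, ∀ t, 0 ≤ t → HasDerivWithinAt (e (i + 1))
      ((R.absorb c).carlemanDiag (e (i + 1) t) + (R.absorb c).carlemanUp
        (if i + 1 < k then e (i + 2) t else tensorPow (appendCoord (x t) c) (i + 2)))
      (Set.Ici 0) t) {i : ℕ} (hi : i < k) {t : ℝ} (ht : 0 ≤ t) :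
    ∑ α, ‖discardExtra (e (i + 1) t) α‖ ^ 2 ≤
      (((f2 * (A ^ 2 + X ^ 2) + f0 * c ^ 2) / (δ * A)) ^ (k - (i + 1)) *
        ((f2 * X ^ 2 + f0 * c ^ 2) / (δ * A))) ^ 2 * (A ^ 2 + X ^ 2) ^ (i + 1) := by
  set U := A ^ 2 + X ^ 2 with hU
  have hU0 : 0 < U := by positivity
  have hX0 : 0 ≤ X := (euclNorm_nonneg _).trans (hX 0 le_rfl)
  have hf2' : 0 ≤ f2 := (norm_nonneg _).trans hf2
  have hf0' : 0 ≤ f0 := (div_nonneg (euclNorm_nonneg _) (sq_nonneg c)).trans hf0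
  have hc2 : 0 < c ^ 2 := by positivity
  let cl : κ ⊕ Unit → Option Bool :=
    Sum.elim (fun i => some (decide ((Λ i).re ≤ -δ))) fun _ => none
  let w : Option Bool → ℝ := fun s => s.elim |c| fun b => if b then A else X
  let ω : Option Bool → Option Bool → ℝ := fun s s' =>
    s.elim (s'.elim (f0 / c ^ 2) fun _ => 0) fun _ => s'.elim 0 fun _ => f2 / U
  have hF1 : (R.absorb c).F1 = Matrix.diagonal (Sum.elim Λ 0) := by
    rw [← Matrix.fromBlocks_diagonal, ← hR]
    simp [absorb]
  have hzz : ∀ t, 0 ≤ t → ∑ r, ‖(R.absorb c).bilin (appendCoord (x t) c)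
      (appendCoord (x t) c) r‖ ^ 2 ≤ (f2 * X ^ 2 + f0 * c ^ 2) ^ 2 := fun t ht => by
    refine (R.sum_norm_sq_absorb_F2_le c _).trans ?_
    have hcc : ‖(c : ℂ) * (c : ℂ)‖ = c ^ 2 := by
      rw [norm_mul, Complex.norm_real, Real.norm_eq_abs, abs_mul_abs_self, sq]
    simp only [appendCoord, Sum.elim_inl, Sum.elim_inr, hcc]
    rw [euclNorm_tensor]
    have := pow_le_pow_left₀ (euclNorm_nonneg _) (hX t ht) 2
    have := euclNorm_nonneg R.F0
    gcongr
  have hF : ∀ v : (κ ⊕ Unit) × (κ ⊕ Unit) → ℂ, ∑ r, ‖((R.absorb c).F2 *ᵥ v) r‖ ^ 2 ≤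
      (f2 * U + f0 * c ^ 2) * ∑ a, ∑ b, ω (cl a) (cl b) * ‖v (a, b)‖ ^ 2 := fun v => by
    have h1 : ∑ a, ∑ b, ω (cl a) (cl b) * ‖v (a, b)‖ ^ 2 =
        f2 / U * euclNorm (fun s : κ × κ => v (Sum.inl s.1, Sum.inl s.2)) ^ 2 +
        f0 / c ^ 2 * ‖v (Sum.inr (), Sum.inr ())‖ ^ 2 := by
      simp [Fintype.sum_sum_type, ω, cl, euclNorm_sq, Fintype.sum_prod_type, Finset.mul_sum]
    rw [h1]
    set p := euclNorm (fun s : κ × κ => v (Sum.inl s.1, Sum.inl s.2))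
    set r := ‖v (Sum.inr (), Sum.inr ())‖
    have hp : 0 ≤ p := euclNorm_nonneg _
    have hr : 0 ≤ r := norm_nonneg _
    calc _ ≤ (‖R.F2‖ * p + euclNorm R.F0 / c ^ 2 * r) ^ 2 := R.sum_norm_sq_absorb_F2_le c v
      _ ≤ (f2 * p + f0 * r) ^ 2 := by
          have := euclNorm_nonneg R.F0
          gcongr
      _ ≤ _ := by
          -- the weighted Cauchy–Schwarz inequality, with an explicit remainder
          have h2 : (f2 * U + f0 * c ^ 2) * (f2 / U * p ^ 2 + f0 / c ^ 2 * r ^ 2) =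
              (f2 * p + f0 * r) ^ 2 + f2 * f0 / (U * c ^ 2) * (p * c ^ 2 - r * U) ^ 2 := by
            field_simp
            ring
          rw [h2]
          have : 0 ≤ f2 * f0 / (U * c ^ 2) * (p * c ^ 2 - r * U) ^ 2 := by positivity
          linarith
  have hz : ∀ t, 0 ≤ t → ∀ s, ∑ a with cl a = s, ‖appendCoord (x t) c a‖ ^ 2 ≤ w s ^ 2 :=
    fun t ht s => by
    rw [Finset.sum_filter, Fintype.sum_sum_type]
    rcases s with _ | b
    · simp [cl, w, appendCoord]
    · have h1 : ∑ a, ‖x t a‖ ^ 2 ≤ X ^ 2 := by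
        rw [← euclNorm_sq]
        exact pow_le_pow_left₀ (euclNorm_nonneg _) (hX t ht) 2
      have h2 : X ^ 2 ≤ w (some b) ^ 2 := by
        cases b
        · exact le_rfl
        · exact pow_le_pow_left₀ hX0 hXA 2
      refine le_trans ?_ (h1.trans h2)
      simp only [cl, appendCoord, Sum.elim_inl, Sum.elim_inr, reduceCtorEq, if_false,
        Finset.sum_const_zero, add_zero]
      exact Finset.sum_le_sum fun a _ => ite_le_sup _ _ _ |>.trans (by simp)
  have hωw : ∑ s, ∑ s', ω s s' * (w s ^ 2 * w s' ^ 2) ≤ f2 * U + f0 * c ^ 2 := by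
    refine le_of_eq ?_
    simp only [Fintype.sum_option, Fintype.sum_bool, ω, w, Option.elim_none, Option.elim_some,
      sq_abs, if_true, Bool.false_eq_true, if_false, zero_mul, add_zero, zero_add]
    field_simp
    rw [hU]
    ring
  have hspec' : ∀ r, cl r ≠ some true → (Sum.elim Λ 0 r : ℂ).re ≤ 0 ∧
      ∀ a b, (R.absorb c).F2 r (a, b) + (R.absorb c).F2 r (b, a) = 0 := fun r hr => by
    rcases r with i | _
    · have hi : ¬ (Λ i).re ≤ -δ := by simpa [cl] using hr
      obtain ⟨h1, h2, h3⟩ := (hspec i).resolve_left hi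
      refine ⟨by simp [h1], fun a b => ?_⟩
      rcases a with a | _ <;> rcases b with b | _ <;> simp [absorb, h2, h3]
    · refine ⟨by simp, fun a b => by simp [absorb]⟩
  have hmain := fun τ => (sectorSq_truncation_error_le cl hF1 (s₀ := some true) hδ
    (fun r hr => by
      rcases r with i | _
      · simpa [cl] using hr
      · simp [cl] at hr)
    (fun r hr => (hspec' r hr).1) (fun r hr => (hspec' r hr).2)
    (fun s s' => by
      rcases s with _ | s <;> rcases s' with _ | s' <;> simp [ω] <;> positivity)
    (w := w) (by simpa [w] using hA) hF hωw hz hzz he0 he (k - (i + 1)) i (by omega) t ht).2 τ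
  have hw : w (some true) = A := rfl
  simp only [hw] at hmain
  set K := ((f2 * U + f0 * c ^ 2) / (δ * A)) ^ (k - (i + 1)) *
    ((f2 * X ^ 2 + f0 * c ^ 2) / (δ * A))
  calc ∑ α, ‖discardExtra (e (i + 1) t) α‖ ^ 2
      = ∑ σ : Fin (i + 1) → Bool, ∑ α with (fun l => decide ((Λ (α l)).re ≤ -δ)) = σ,
          ‖discardExtra (e (i + 1) t) α‖ ^ 2 := (Finset.sum_fiberwise _ _ _).symm
    _ ≤ ∑ σ : Fin (i + 1) → Bool, sectorSq cl (fun l => some (σ l)) (e (i + 1) t) := by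
        refine Finset.sum_le_sum fun σ _ => ?_
        refine (Finset.sum_image (g := fun α : Fin (i + 1) → κ => fun l => Sum.inl (α l))
          (f := fun β => ‖e (i + 1) t β‖ ^ 2) fun α _ β _ h => ?_).symm.trans_le ?_
        · exact funext fun l => Sum.inl_injective (congrFun h l)
        · refine Finset.sum_le_sum_of_subset_of_nonneg (fun β hβ => ?_) fun _ _ _ => sq_nonneg _
          obtain ⟨α, hα, rfl⟩ := Finset.mem_image.1 hβ
          have := (Finset.mem_filter.1 hα).2
          refine Finset.mem_filter.2 ⟨Finset.mem_univ _, ?_⟩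
          rw [← this]
          rfl
    _ ≤ ∑ σ : Fin (i + 1) → Bool, (K * ∏ l, w (some (σ l))) ^ 2 :=
        Finset.sum_le_sum fun σ _ => hmain _
    _ = K ^ 2 * ∏ _l : Fin (i + 1), ∑ b : Bool, w (some b) ^ 2 := by
        rw [Finset.prod_univ_sum, Fintype.piFinset_univ, Finset.mul_sum]
        exact Finset.sum_congr rfl fun σ _ => by rw [mul_pow, Finset.prod_pow]
    _ = K ^ 2 * U ^ (i + 1) := by simp [w, hU]

end QuadSystem

namespace QuadSystem

variable {κ : Type*} [Fintype κ]

/-- Solutions of a quadratic system are determined by their initial value. -/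
lemma IsSolution.eq_of_eq_zero {S : QuadSystem κ} {z z' : ℝ → κ → ℂ} (hz : S.IsSolution z)
    (hz' : S.IsSolution z') (h0 : z 0 = z' 0) (t : ℝ) (ht : 0 ≤ t) : z t = z' t := by
  have hsub : Set.Icc 0 t ⊆ Set.Ici 0 := fun s hs => hs.1
  have hc : ∀ {z : ℝ → κ → ℂ}, S.IsSolution z → ContinuousOn z (Set.Icc 0 t) := fun hz s hs =>
    (hz s hs.1).continuousWithinAt.mono hsub
  have hder : ∀ {z : ℝ → κ → ℂ}, S.IsSolution z → ∀ s ∈ Set.Ico 0 t,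
      HasDerivWithinAt z (S.field (z s)) (Set.Ici s) s := fun hz s hs =>
    (hz s hs.1).mono fun r hr => le_trans hs.1 hr
  have hfield : ContDiff ℝ 1 S.field := by
    refine contDiff_pi.2 fun i => ?_
    simp only [field, Pi.add_apply, Matrix.mulVec, dotProduct]
    fun_prop
  -- on a ball that contains both trajectories up to time `t`, the field is Lipschitz
  obtain ⟨r, hr⟩ := ((isCompact_Icc.image_of_continuousOn (hc hz)).union
    (isCompact_Icc.image_of_continuousOn (hc hz'))).isBounded.subset_closedBall (0 : κ → ℂ)
  obtain ⟨K, hK⟩ := hfield.contDiffOn.exists_lipschitzOnWith one_ne_zero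
    (convex_closedBall (0 : κ → ℂ) r) (isCompact_closedBall _ _)
  exact ODE_solution_unique_of_mem_Icc_right (v := fun _ => S.field)
    (s := fun _ => Metric.closedBall 0 r) (fun _ _ => hK) (hc hz) (hder hz)
    (fun s hs => hr (Or.inl ⟨s, ⟨hs.1, hs.2.le⟩, rfl⟩)) (hc hz') (hder hz')
    (fun s hs => hr (Or.inr ⟨s, ⟨hs.1, hs.2.le⟩, rfl⟩)) h0 ⟨ht, le_rfl⟩

lemma field_rescale (S : QuadSystem κ) {γ : ℝ} (hγ : γ ≠ 0) (v : κ → ℂ) :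
    (S.rescale γ).field ((γ : ℂ) • v) = (γ : ℂ) • S.field v := by
  have hγ' : (γ : ℂ) ≠ 0 := by exact_mod_cast hγ
  have h : (fun s : κ × κ => ((γ : ℂ) • v) s.1 * ((γ : ℂ) • v) s.2) =
      ((γ : ℂ) * γ) • fun s : κ × κ => v s.1 * v s.2 := by
    ext s
    simp only [Pi.smul_apply, smul_eq_mul]
    ring
  simp only [field, rescale, h, Matrix.mulVec_smul, Matrix.smul_mulVec, smul_add, smul_smul]
  rw [mul_assoc, mul_inv_cancel₀ hγ', mul_one]

lemma field_absorb (R : QuadSystem κ) {c : ℝ} (hc : c ≠ 0) (v : κ → ℂ) :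
    (R.absorb c).field (appendCoord v c) = Sum.elim (R.field v) 0 := by
  have hc' : (c : ℂ) ≠ 0 := by exact_mod_cast hc
  rw [field, absorb_F2_mulVec]
  have h1 : (R.absorb c).F0 = 0 := rfl
  have h2 : (R.absorb c).F1 = Matrix.fromBlocks R.F1 0 0 0 := rfl
  rw [h1, h2, appendCoord, Matrix.fromBlocks_mulVec]
  ext r
  rcases r with i | _
  · simp [field, ← sq, hc']
    ring
  · simp

lemma isSolution_absorb_rescale {S : QuadSystem κ} {x : ℝ → κ → ℂ} (hx : S.IsSolution x)
    {γ c : ℝ} (hγ : γ ≠ 0) (hc : c ≠ 0) :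
    ((S.rescale γ).absorb c).IsSolution fun t => appendCoord ((γ : ℂ) • x t) c := by
  intro t ht
  rw [field_absorb _ hc, field_rescale _ hγ, hasDerivWithinAt_pi]
  rintro (i | _)
  · exact (hasDerivWithinAt_pi.1 (hx t ht) i).const_mul (γ : ℂ)
  · exact hasDerivWithinAt_const _ _ _

/-! ### Diagonalization, conserved quantities and the spectral gap -/

lemma kronecker_mulVec_tensor (Q : Matrix κ κ ℂ) (u v : κ → ℂ) :
    (Q ⊗ₖ Q) *ᵥ (fun s : κ × κ => u s.1 * v s.2) =
      fun s : κ × κ => (Q *ᵥ u) s.1 * (Q *ᵥ v) s.2 := by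
  ext s
  simp only [Matrix.mulVec, dotProduct, Fintype.sum_prod_type, Matrix.kroneckerMap_apply,
    Finset.sum_mul_sum]
  exact Finset.sum_congr rfl fun a _ => Finset.sum_congr rfl fun b _ => by ring

/-- A linear functional in the span of conserved quantities annihilates the driving term, and the
quadratic form of the nonlinearity; it need not annihilate the antisymmetric part of `F2`. -/
lemma dotProduct_eq_zero_of_mem_span {S : QuadSystem κ} {ι : Type*} {q : ι → κ → ℂ}
    (hq : ∀ m, S.IsConserved (q m)) {r : κ → ℂ}
    (hr : r ∈ Submodule.span ℂ (Set.range fun m => star (q m))) :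
    r ⬝ᵥ S.F0 = 0 ∧ ∀ u v, r ⬝ᵥ S.bilin u v + r ⬝ᵥ S.bilin v u = 0 := by
  have hfield : ∀ v, r ⬝ᵥ S.field v = 0 := fun v => by
    induction hr using Submodule.span_induction with
    | mem s hs =>
      obtain ⟨m, rfl⟩ := hs
      exact hq m v
    | zero => exact zero_dotProduct _
    | add s s' _ _ h h' => rw [add_dotProduct, h, h', add_zero]
    | smul a s _ h => rw [smul_dotProduct, h, smul_zero]
  have h0 : r ⬝ᵥ S.F0 = 0 := by
    have h := hfield 0
    simp only [field, Matrix.mulVec_zero, Pi.zero_apply, mul_zero] at h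
    have h1 : S.F2 *ᵥ (fun _ : κ × κ => (0 : ℂ)) = 0 := Matrix.mulVec_zero _
    rwa [h1, add_zero, add_zero] at h
  have hquad : ∀ v, r ⬝ᵥ S.bilin v v = 0 := fun v => by
    have h1 := hfield v
    have h2 := hfield (-v)
    simp only [field, Matrix.mulVec_neg, Pi.neg_apply, neg_mul_neg, dotProduct_add, dotProduct_neg,
      h0] at h1 h2
    change r ⬝ᵥ (S.F2 *ᵥ _) = 0
    linear_combination (h1 + h2) / 2
  refine ⟨h0, fun u v => ?_⟩
  have h : S.bilin (u + v) (u + v) = S.bilin u u + S.bilin u v + (S.bilin v u + S.bilin v v) := by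
    simp only [bilin, ← Matrix.mulVec_add]
    congr 1
    ext s
    simp only [Pi.add_apply]
    ring
  have h1 := hquad (u + v)
  rw [h] at h1
  simp only [dotProduct_add, hquad] at h1
  linear_combination h1

variable [DecidableEq κ]

/-- The system in the coordinates `Q⁻¹ x`, for `F1 = Q (diagonal Λ) Q⁻¹`. -/
def diagonalized (S : QuadSystem κ) (Q : Matrix κ κ ℂ) (Λ : κ → ℂ) : QuadSystem κ where
  F0 := Q⁻¹ *ᵥ S.F0
  F1 := Matrix.diagonal Λ
  F2 := Q⁻¹ * S.F2 * (Q ⊗ₖ Q)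

lemma mulVec_bilin (S : QuadSystem κ) {Q : Matrix κ κ ℂ} (hQ : IsUnit Q.det) (Λ : κ → ℂ)
    (u v : κ → ℂ) :
    Q⁻¹ *ᵥ S.bilin u v = (S.diagonalized Q Λ).bilin (Q⁻¹ *ᵥ u) (Q⁻¹ *ᵥ v) := by
  rw [bilin, bilin, diagonalized, ← Matrix.mulVec_mulVec, kronecker_mulVec_tensor]
  simp only [Matrix.mulVec_mulVec, Matrix.mul_nonsing_inv _ hQ, Matrix.one_mulVec]

/-- The modes related to conserved quantities are not driven, and their quadratic coupling has no
symmetric part. -/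
lemma diagonalized_row_of_mem_span {S : QuadSystem κ} {ι : Type*} {q : ι → κ → ℂ}
    (hq : ∀ m, S.IsConserved (q m)) (Q : Matrix κ κ ℂ) (Λ : κ → ℂ) {i : κ}
    (hi : Q⁻¹ i ∈ Submodule.span ℂ (Set.range fun m => star (q m))) :
    (S.diagonalized Q Λ).F0 i = 0 ∧ ∀ a b,
      (S.diagonalized Q Λ).F2 i (a, b) + (S.diagonalized Q Λ).F2 i (b, a) = 0 := by
  obtain ⟨h0, h2⟩ := dotProduct_eq_zero_of_mem_span hq hi
  refine ⟨h0, fun a b => ?_⟩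
  have hentry : ∀ a b, (S.diagonalized Q Λ).F2 i (a, b) =
      Q⁻¹ i ⬝ᵥ S.bilin (fun k => Q k a) (fun k => Q k b) := fun a b => by
    rw [diagonalized, Matrix.mul_assoc]
    rfl
  rw [hentry, hentry, h2]

/-- The real spectral gap of a diagonalizable matrix. -/
lemma realSpectralGap_pos_and_le {A Q : Matrix κ κ ℂ} {Λ : κ → ℂ}
    (hQ : IsUnit Q.det) (hA : A = Q * Matrix.diagonal Λ * Q⁻¹) (hgap : ∃ i, (Λ i).re ≠ 0)
    (hneg : ∀ i, (Λ i).re ≠ 0 → (Λ i).re < 0) :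
    0 < realSpectralGap A ∧ ∀ i, (Λ i).re ≠ 0 → (Λ i).re ≤ -realSpectralGap A := by
  have hspec : spectrum ℂ A = Set.range Λ := by
    obtain ⟨u, rfl⟩ := (Matrix.isUnit_iff_isUnit_det Q).2 hQ
    rw [hA, ← Matrix.coe_units_inv, spectrum.units_conjugate, spectrum_diagonal]
  set s : Set ℝ := Complex.re '' {μ ∈ spectrum ℂ A | μ.re ≠ 0} with hs
  have hmem : ∀ i, (Λ i).re ≠ 0 → (Λ i).re ∈ s := fun i hi =>
    ⟨Λ i, ⟨by rw [hspec]; exact ⟨i, rfl⟩, hi⟩, rfl⟩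
  have hfin : s.Finite :=
    ((hspec ▸ Set.finite_range Λ).subset (Set.sep_subset _ _)).image _
  have hne : s.Nonempty := hgap.elim fun i hi => ⟨_, hmem i hi⟩
  have hA' : realSpectralGap A = -sSup s := rfl
  rw [hA', neg_neg]
  refine ⟨neg_pos.2 ?_, fun i hi => le_csSup hfin.bddAbove (hmem i hi)⟩
  obtain ⟨μ, ⟨hμ, hre⟩, h⟩ := hne.csSup_mem hfin
  obtain ⟨i, rfl⟩ : μ ∈ Set.range Λ := hspec ▸ hμ
  exact h ▸ hneg i hre

end QuadSystem

/-! ### The error bound -/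

lemma hasDerivWithinAt_tensorMap {κ κ' : Type*} [Fintype κ] [Fintype κ'] (P : Matrix κ' κ ℂ)
    {j : ℕ} {f : ℝ → (Fin j → κ) → ℂ} {f' : (Fin j → κ) → ℂ} {s : Set ℝ} {t : ℝ}
    (hf : HasDerivWithinAt f f' s t) :
    HasDerivWithinAt (fun t => tensorMap P j (f t)) (tensorMap P j f') s t :=
  ((tensorMap P j).restrictScalars ℝ).toContinuousLinearMap.hasFDerivAt.comp_hasDerivWithinAt t hf

/-- `x ↦ e ^ x / x` is increasing along the integers `1 ≤ j < k + 1`. -/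
lemma exp_pow_mul_le {j k : ℕ} (hj : 1 ≤ j) (hjk : j ≤ k) :
    Real.exp 1 ^ j * (k + 1) ≤ j * Real.exp 1 ^ (k + 1) := by
  obtain ⟨d, rfl⟩ := Nat.exists_eq_add_of_le hjk
  have h1 : (d + 1 : ℝ) + 1 ≤ Real.exp 1 ^ (d + 1) := by
    have := Real.add_one_le_exp ((d + 1 : ℕ) : ℝ)
    rw [← Real.exp_one_pow] at this
    exact_mod_cast this
  have hj' : (1 : ℝ) ≤ j := by exact_mod_cast hj
  have h2 : (j : ℝ) + d + 1 ≤ j * Real.exp 1 ^ (d + 1) := by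
    have hd : (0 : ℝ) ≤ d := Nat.cast_nonneg d
    nlinarith
  have h3 : (0 : ℝ) < Real.exp 1 ^ j := by positivity
  calc Real.exp 1 ^ j * (((j + d : ℕ) : ℝ) + 1) = Real.exp 1 ^ j * (j + d + 1) := by push_cast; ring
    _ ≤ Real.exp 1 ^ j * (j * Real.exp 1 ^ (d + 1)) := by gcongr
    _ = _ := by ring

namespace QuadSystem

variable {κ : Type*} [Fintype κ] [DecidableEq κ]

/-- The quantitative truncation bound before the constants are simplified; `f2` and `f0` bound the
two parts of the embedded nonlinearity in the diagonalizing coordinates. -/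
lemma euclNorm_truncation_error_le {S : QuadSystem κ} {Q : Matrix κ κ ℂ} {Λ : κ → ℂ}
    (hQ : IsUnit Q.det) (hdiag : S.F1 = Q * Matrix.diagonal Λ * Q⁻¹) {δ : ℝ} (hδ : 0 < δ)
    (hspec : ∀ i, (Λ i).re ≤ -δ ∨ Λ i = 0 ∧ (S.diagonalized Q Λ).F0 i = 0 ∧
      ∀ a b, (S.diagonalized Q Λ).F2 i (a, b) + (S.diagonalized Q Λ).F2 i (b, a) = 0)
    {x : ℝ → κ → ℂ} (hx : S.IsSolution x) {γ c : ℝ} (hγ : 0 < γ) (hc : c ≠ 0) {A X : ℝ}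
    (hA : 0 < A) (hXA : X ≤ A) (hX : ∀ t, 0 ≤ t → euclNorm ((γ : ℂ) • (Q⁻¹ *ᵥ x t)) ≤ X)
    {f2 f0 : ℝ} (hf2 : S.normF2 Q / γ ≤ f2) (hf0 : γ * S.normF0 Q / c ^ 2 ≤ f0)
    {k : ℕ} {y : (j : ℕ) → ℝ → (Fin j → κ ⊕ Unit) → ℂ}
    (hy : ((S.rescale γ).absorb c).IsCarlemanSolution k (appendCoord ((γ : ℂ) • x 0) c) y)
    {j : ℕ} (hj : 1 ≤ j) (hjk : j ≤ k) {t : ℝ} (ht : 0 ≤ t) :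
    euclNorm (tensorPow ((γ : ℂ) • x t) j - discardExtra (y j t)) ≤
      ‖Q‖ ^ j * (((f2 * (A ^ 2 + X ^ 2) + f0 * c ^ 2) / (δ * A)) ^ (k - j) *
        ((f2 * X ^ 2 + f0 * c ^ 2) / (δ * A))) * (2 * A) ^ j := by
  obtain ⟨i, rfl⟩ : ∃ i, j = i + 1 := ⟨j - 1, by omega⟩
  set E := (S.rescale γ).absorb c with hE
  set R := (S.diagonalized Q Λ).rescale γ with hR
  set P : Matrix (κ ⊕ Unit) (κ ⊕ Unit) ℂ := Matrix.fromBlocks Q⁻¹ 0 0 1 with hP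
  have hPv : ∀ v : κ ⊕ Unit → ℂ,
      P *ᵥ v = Sum.elim (Q⁻¹ *ᵥ (v ∘ Sum.inl)) (v ∘ Sum.inr) := fun v => by
    rw [hP, Matrix.fromBlocks_mulVec]
    simp
  have hPF1 : P * E.F1 = (R.absorb c).F1 * P := by
    have h : Q⁻¹ * S.F1 = Matrix.diagonal Λ * Q⁻¹ := by
      rw [hdiag, mul_assoc, ← mul_assoc, Matrix.nonsing_inv_mul _ hQ, one_mul]
    simp [hP, hE, hR, absorb, rescale, diagonalized, Matrix.fromBlocks_multiply, h]
  have hPbilin : ∀ u v, P *ᵥ E.bilin u v = (R.absorb c).bilin (P *ᵥ u) (P *ᵥ v) := fun u v => by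
    have h := S.mulVec_bilin hQ Λ (u ∘ Sum.inl) (v ∘ Sum.inl)
    simp only [bilin] at h
    rw [bilin, bilin, absorb_F2_mulVec, absorb_F2_mulVec, hPv, hPv u, hPv v]
    ext r
    rcases r with r | _
    · have h' := congrFun h r
      simp only [Function.comp_apply] at h'
      simp only [Sum.elim_inl, Sum.elim_inr, rescale, hR, Sum.elim_comp_inl, Matrix.mulVec_add,
        Matrix.mulVec_smul, Matrix.smul_mulVec, Pi.add_apply, Pi.smul_apply, h',
        Function.comp_apply, diagonalized]
    · simp
  have hsol := isSolution_absorb_rescale hx hγ.ne' hc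
  set z : ℝ → κ ⊕ Unit → ℂ := fun t => appendCoord ((γ : ℂ) • x t) c with hz
  let e : (j : ℕ) → ℝ → (Fin j → κ ⊕ Unit) → ℂ := fun j t =>
    tensorMap P j (tensorPow (z t) j - y j t)
  have he0 : ∀ i < k, e (i + 1) 0 = 0 := fun i hi => by
    simp only [e]
    rw [(hy.2 i hi).1, sub_self, map_zero]
  have hPz : ∀ t, P *ᵥ z t = appendCoord ((γ : ℂ) • (Q⁻¹ *ᵥ x t)) c := fun t => by
    rw [hPv, ← Matrix.mulVec_smul]
    rfl
  have he : ∀ i < k, ∀ t, 0 ≤ t → HasDerivWithinAt (e (i + 1))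
      ((R.absorb c).carlemanDiag (e (i + 1) t) + (R.absorb c).carlemanUp
        (if i + 1 < k then e (i + 2) t else
          tensorPow (appendCoord ((γ : ℂ) • (Q⁻¹ *ᵥ x t)) c) (i + 2)))
      (Set.Ici 0) t := fun i hi t ht => by
    have h := (E.hasDerivWithinAt_tensorPow rfl (hsol t ht) (i + 1)).sub ((hy.2 i hi).2 t ht)
    refine (hasDerivWithinAt_tensorMap P h).congr_deriv ?_
    have hdown : E.carlemanDown (y i t) = 0 := by
      ext α
      simp [carlemanDown, hE, absorb]
    have hsubD : ∀ u v : (Fin (i + 1) → κ ⊕ Unit) → ℂ, E.carlemanDiag (u - v) =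
        E.carlemanDiag u - E.carlemanDiag v := (E.carlemanDiagLin (i + 1)).map_sub
    have hsubU : ∀ u v : (Fin (i + 2) → κ ⊕ Unit) → ℂ, E.carlemanUp (u - v) =
        E.carlemanUp u - E.carlemanUp v := fun u v => by
      simp only [← carlemanUpLin_apply, map_sub]
    rw [hdown, zero_add, ← hPz, ← tensorMap_tensorPow]
    simp only [e]
    rw [← tensorMap_carlemanDiag hPF1, hsubD]
    split_ifs
    · rw [← tensorMap_carlemanUp hPbilin, hsubU, ← map_add]
      congr 1
      abel
    · rw [← tensorMap_carlemanUp hPbilin, ← map_add]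
      congr 1
      abel
  have hRspec : ∀ i, (Λ i).re ≤ -δ ∨ Λ i = 0 ∧ R.F0 i = 0 ∧
      ∀ a b, R.F2 i (a, b) + R.F2 i (b, a) = 0 := fun i => by
    refine (hspec i).imp_right fun ⟨h1, h2, h3⟩ => ⟨h1, ?_, fun a b => ?_⟩
    · simp [hR, rescale, h2]
    · simp only [hR, rescale, Matrix.smul_apply, ← smul_add, h3, smul_zero]
  have hRF2 : ‖R.F2‖ ≤ f2 := by
    refine le_trans (le_of_eq ?_) hf2
    change ‖((γ : ℂ)⁻¹) • (Q⁻¹ * S.F2 * (Q ⊗ₖ Q))‖ = _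
    rw [norm_smul, norm_inv, Complex.norm_real, Real.norm_of_nonneg hγ.le, normF2]
    ring
  have hRF0 : euclNorm R.F0 / c ^ 2 ≤ f0 := by
    refine le_trans (le_of_eq ?_) hf0
    change euclNorm ((γ : ℂ) • (Q⁻¹ *ᵥ S.F0)) / c ^ 2 = _
    rw [euclNorm_smul, Complex.norm_real, Real.norm_of_nonneg hγ.le, normF0]
  have hmain := sum_norm_sq_discardExtra_error_le (R := R) rfl hδ hRspec hA hXA hc hRF2 hRF0 hX
    he0 he (show i < k by omega) ht
  have hback : tensorPow ((γ : ℂ) • x t) (i + 1) - discardExtra (y (i + 1) t) =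
      tensorMap Q (i + 1) (discardExtra (e (i + 1) t)) := by
    have hQP : Matrix.fromBlocks Q 0 0 1 * P = 1 := by
      simp [hP, Matrix.fromBlocks_multiply, Matrix.mul_nonsing_inv _ hQ]
    rw [← discardExtra_tensorMap, tensorMap_tensorMap, hQP, tensorMap_one]
    rfl
  have hX0 : 0 ≤ X := (euclNorm_nonneg _).trans (hX 0 le_rfl)
  have hf2' : 0 ≤ f2 := (norm_nonneg _).trans hRF2
  have hf0' : 0 ≤ f0 := (div_nonneg (euclNorm_nonneg _) (sq_nonneg c)).trans hRF0
  refine (pow_le_pow_iff_left₀ (euclNorm_nonneg _) (by positivity) two_ne_zero).1 ?_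
  rw [hback, euclNorm_sq]
  refine (sum_norm_sq_tensorMap_le Q _ _).trans ?_
  set K := ((f2 * (A ^ 2 + X ^ 2) + f0 * c ^ 2) / (δ * A)) ^ (k - (i + 1)) *
    ((f2 * X ^ 2 + f0 * c ^ 2) / (δ * A))
  calc _ ≤ (‖Q‖ ^ 2) ^ (i + 1) * (K ^ 2 * (A ^ 2 + X ^ 2) ^ (i + 1)) := by gcongr
    _ ≤ (‖Q‖ ^ 2) ^ (i + 1) * (K ^ 2 * ((2 * A) ^ 2) ^ (i + 1)) := by
        gcongr
        nlinarith
    _ = _ := by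
        generalize 2 * A = B
        ring

lemma normF2_pos {S : QuadSystem κ} {Q : Matrix κ κ ℂ} (hQ : IsUnit Q.det) (hF2 : S.F2 ≠ 0) :
    0 < S.normF2 Q := by
  refine norm_pos_iff.2 fun h => hF2 ?_
  have h1 : S.F2 = Q * (Q⁻¹ * S.F2 * (Q ⊗ₖ Q)) * (Q⁻¹ ⊗ₖ Q⁻¹) := by
    have h2 : (Q ⊗ₖ Q) * (Q⁻¹ ⊗ₖ Q⁻¹) = 1 := by
      rw [← Matrix.mul_kronecker_mul, Matrix.mul_nonsing_inv _ hQ, Matrix.one_kronecker_one]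
    rw [Matrix.mul_assoc, Matrix.mul_assoc, h2, Matrix.mul_one, ← Matrix.mul_assoc,
      Matrix.mul_nonsing_inv _ hQ, Matrix.one_mul]
  rw [h1, h]
  simp

lemma normF0_nonneg (S : QuadSystem κ) (Q : Matrix κ κ ℂ) : 0 ≤ S.normF0 Q := euclNorm_nonneg _

lemma normF0_pos {S : QuadSystem κ} {Q : Matrix κ κ ℂ} (hQ : IsUnit Q.det) (hF0 : S.F0 ≠ 0) :
    0 < S.normF0 Q := by
  refine (S.normF0_nonneg Q).lt_of_ne' fun h => hF0 ?_
  have h1 : Q⁻¹ *ᵥ S.F0 = 0 := (WithLp.toLp_eq_zero 2).1 (norm_eq_zero.1 h)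
  rw [← Matrix.one_mulVec S.F0, ← Matrix.mul_nonsing_inv _ hQ, ← Matrix.mulVec_mulVec, h1,
    Matrix.mulVec_zero]

/-- The error bound with the rescaling `γ = p γ₀`. -/
theorem euclNorm_truncation_error_le_Rups {S : QuadSystem κ} {Q : Matrix κ κ ℂ} {Λ : κ → ℂ}
    (hQ : IsUnit Q.det) (hdiag : S.F1 = Q * Matrix.diagonal Λ * Q⁻¹)
    (hδ : 0 < realSpectralGap S.F1)
    (hspec : ∀ i, (Λ i).re ≤ -realSpectralGap S.F1 ∨ Λ i = 0 ∧ (S.diagonalized Q Λ).F0 i = 0 ∧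
      ∀ a b, (S.diagonalized Q Λ).F2 i (a, b) + (S.diagonalized Q Λ).F2 i (b, a) = 0)
    {x : ℝ → κ → ℂ} (hx : S.IsSolution x) {X : ℝ} (hX : ∀ t, 0 ≤ t → euclNorm (Q⁻¹ *ᵥ x t) ≤ X)
    {υ p γ : ℝ} (hυ : υ ≠ 0) (hp : 0 < p) (hγp : γ = p * S.gammaZero Q) (hγ : 0 < γ)
    {k : ℕ} {y : (j : ℕ) → ℝ → (Fin j → κ ⊕ Unit) → ℂ}
    (hy : ((S.rescale γ).absorb (γ * υ)).IsCarlemanSolution k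
      (appendCoord ((γ : ℂ) • x 0) (γ * υ)) y)
    {j : ℕ} (hj : 1 ≤ j) (hjk : j ≤ k) {t : ℝ} (ht : 0 ≤ t) :
    euclNorm (tensorPow ((γ : ℂ) • x t) j - discardExtra (y j t)) ≤
      j / (2 * (k + 1)) * p ^ j * S.Rups Q X υ ^ (k + 1) := by
  set δ := realSpectralGap S.F1 with hδdef
  set m := max (S.normF2 Q) (S.normF0 Q / υ ^ 2) with hm
  set W := √(X ^ 2 + υ ^ 2) with hW
  have hυ2 : 0 < υ ^ 2 := by positivity
  have hW2 : W ^ 2 = X ^ 2 + υ ^ 2 := Real.sq_sqrt (by positivity)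
  have hW0 : 0 < W := Real.sqrt_pos.2 (by positivity)
  have hX0 : 0 ≤ X := (euclNorm_nonneg _).trans (hX 0 le_rfl)
  have hXW : X ≤ W := Real.le_sqrt_of_sq_le (by linarith)
  have hm0 : 0 ≤ m := le_max_of_le_left (norm_nonneg _)
  have herr := euclNorm_truncation_error_le (A := γ * W) (X := γ * X) (c := γ * υ)
    (f2 := m / γ) (f0 := m / γ) hQ hdiag hδ hspec hx hγ (mul_ne_zero hγ.ne' hυ)
    (mul_pos hγ hW0) (by gcongr)
    (fun t ht => by
      rw [euclNorm_smul, Complex.norm_real, Real.norm_of_nonneg hγ.le]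
      exact mul_le_mul_of_nonneg_left (hX t ht) hγ.le)
    (by gcongr; exact le_max_left _ _)
    (by
      have h : γ * S.normF0 Q / (γ * υ) ^ 2 = S.normF0 Q / υ ^ 2 / γ := by field_simp
      rw [h]
      gcongr
      exact le_max_right _ _)
    hy hj hjk ht
  set u := 2 * m * W / δ with hu
  have hu0 : 0 ≤ u := by positivity
  have h1 : (m / γ * ((γ * W) ^ 2 + (γ * X) ^ 2) + m / γ * (γ * υ) ^ 2) / (δ * (γ * W)) = u := by
    have : m / γ * ((γ * W) ^ 2 + (γ * X) ^ 2) + m / γ * (γ * υ) ^ 2 =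
        m * γ * (W ^ 2 + (X ^ 2 + υ ^ 2)) := by
      field_simp
      ring
    rw [this, ← hW2, hu]
    field_simp
    ring
  have h2 : (m / γ * (γ * X) ^ 2 + m / γ * (γ * υ) ^ 2) / (δ * (γ * W)) = u / 2 := by
    have : m / γ * (γ * X) ^ 2 + m / γ * (γ * υ) ^ 2 = m * γ * (X ^ 2 + υ ^ 2) := by
      field_simp
    rw [this, ← hW2, hu]
    field_simp
  rw [h1, h2] at herr
  -- the choice of `γ₀` makes `γ ‖Q‖` comparable to `m / δ`
  have h3 : ‖Q‖ * (2 * (γ * W)) ≤ p * Real.exp 1 * u := by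
    have hQ0 : ‖Q‖ ≠ 0 := by
      rintro h
      rw [hγp, gammaZero, h] at hγ
      simp at hγ
    have : ‖Q‖ * (2 * (γ * W)) = p * Real.exp 1 * (2 * S.normF2 Q * W / δ) := by
      rw [hγp, gammaZero, ← hδdef]
      field_simp
    rw [this, hu]
    gcongr
    exact le_max_left _ _
  have h4 := exp_pow_mul_le hj hjk
  have hR : S.Rups Q X υ = Real.exp 1 * u := by
    rw [Rups, ← hm, ← hW, ← hδdef, hu]
    ring
  calc _ ≤ ‖Q‖ ^ j * (u ^ (k - j) * (u / 2)) * (2 * (γ * W)) ^ j := herr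
    _ = (‖Q‖ * (2 * (γ * W))) ^ j * (u ^ (k - j) * (u / 2)) := by ring
    _ ≤ (p * Real.exp 1 * u) ^ j * (u ^ (k - j) * (u / 2)) := by gcongr
    _ = p ^ j / (2 * (k + 1)) * (Real.exp 1 ^ j * (k + 1)) * u ^ (k + 1) := by
        have : u ^ (k + 1) = u ^ j * u ^ (k - j) * u := by
          rw [← pow_add, Nat.add_sub_cancel' hjk, pow_succ]
        rw [this, mul_pow, mul_pow]
        field_simp
    _ ≤ p ^ j / (2 * (k + 1)) * (j * Real.exp 1 ^ (k + 1)) * u ^ (k + 1) := by gcongr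
    _ = _ := by
        rw [hR]
        ring

end QuadSystem

/-! ### The optimal parameter -/

/-- The balance `s = b / a` of the two terms of the maximum is the unique minimizer. -/
lemma sqrt_mul_max_lt {a b X s : ℝ} (ha : 0 < a) (hb : 0 < b) (hs : 0 < s) (hne : s ≠ b / a) :
    a * √(X ^ 2 + b / a) < √(X ^ 2 + s) * max a (b / s) := by
  have hpos : 0 < √(X ^ 2 + s) := Real.sqrt_pos.2 (by positivity)
  rcases lt_or_gt_of_ne hne with h | h
  · have h1 : a < b / s := by rwa [lt_div_iff₀ hs, mul_comm, ← lt_div_iff₀ ha]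
    refine lt_of_lt_of_le ?_ (mul_le_mul_of_nonneg_left (le_max_right _ _) hpos.le)
    refine lt_of_pow_lt_pow_left₀ 2 (by positivity) ?_
    rw [mul_pow, mul_pow, Real.sq_sqrt (by positivity), Real.sq_sqrt (by positivity)]
    have h2 : a ^ 2 ≤ (b / s) ^ 2 := pow_le_pow_left₀ ha.le h1.le 2
    have h3 : a ^ 2 * (b / a) = a * b := by field_simp
    have h4 : s * (b / s) ^ 2 = b / s * b := by field_simp
    have h5 : a * b < b / s * b := by gcongr
    nlinarith [mul_le_mul_of_nonneg_left h2 (sq_nonneg X)]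
  · calc a * √(X ^ 2 + b / a) < a * √(X ^ 2 + s) := by gcongr
      _ ≤ √(X ^ 2 + s) * max a (b / s) := by
        rw [mul_comm]
        gcongr
        exact le_max_left _ _

namespace QuadSystem

variable {κ : Type*} [Fintype κ] [DecidableEq κ]

lemma Rdelta_lt_Rups {S : QuadSystem κ} {Q : Matrix κ κ ℂ} (hδ : 0 < realSpectralGap S.F1)
    (h2 : 0 < S.normF2 Q) (h0 : 0 < S.normF0 Q) (X : ℝ) {υ : ℝ} (hυ : υ ≠ 0)
    (hne : |υ| ≠ S.upsStar Q) : S.Rdelta Q X < S.Rups Q X υ := by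
  have h := sqrt_mul_max_lt (X := X) h2 h0 (s := υ ^ 2) (by positivity) fun h => hne <| by
    rw [upsStar, ← h, Real.sqrt_sq_eq_abs]
  rw [Rdelta, Rups, mul_assoc, mul_assoc _ (√_)]
  gcongr

lemma Rups_upsStar {S : QuadSystem κ} {Q : Matrix κ κ ℂ} (h2 : 0 < S.normF2 Q)
    (h0 : 0 < S.normF0 Q) (X : ℝ) : S.Rups Q X (S.upsStar Q) = S.Rdelta Q X := by
  have h : S.upsStar Q ^ 2 = S.normF0 Q / S.normF2 Q := Real.sq_sqrt (by positivity)
  have h' : S.normF0 Q / (S.normF0 Q / S.normF2 Q) = S.normF2 Q := by field_simp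
  rw [Rups, Rdelta, h, h', max_self]
  ring

lemma Rups_abs (S : QuadSystem κ) (Q : Matrix κ κ ℂ) (X υ : ℝ) :
    S.Rups Q X |υ| = S.Rups Q X υ := by
  simp only [Rups, sq_abs]

/-- Without driving, a small `υ` does not spoil the convergence criterion. -/
lemma exists_Rups_lt_one {S : QuadSystem κ} {Q : Matrix κ κ ℂ} (h0 : S.normF0 Q = 0) {X : ℝ}
    (hR : S.Rdelta Q X < 1) : ∃ υ : ℝ, 0 < υ ∧ S.Rups Q X υ < 1 := by
  have hcont : Continuous fun υ : ℝ =>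
      2 * Real.exp 1 * √(X ^ 2 + υ ^ 2) * S.normF2 Q / realSpectralGap S.F1 := by fun_prop
  have hlt : (fun υ : ℝ => 2 * Real.exp 1 * √(X ^ 2 + υ ^ 2) * S.normF2 Q /
      realSpectralGap S.F1) 0 < 1 := by
    refine lt_of_eq_of_lt ?_ hR
    simp only [Rdelta, h0, zero_div, ne_eq, OfNat.ofNat_ne_zero, not_false_eq_true, zero_pow]
    ring
  have hev := (hcont.tendsto 0).eventually (gt_mem_nhds hlt)
  obtain ⟨υ, h1, h2⟩ := ((hev.filter_mono nhdsWithin_le_nhds).and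
    (self_mem_nhdsWithin : Set.Ioi (0 : ℝ) ∈ nhdsWithin 0 (Set.Ioi 0))).exists
  refine ⟨υ, h2, ?_⟩
  have hmax : max (S.normF2 Q) 0 = S.normF2 Q := max_eq_left (norm_nonneg _)
  rwa [Rups, h0, zero_div, hmax]

end QuadSystem

/-- Summation of the block errors: if every block is bounded by `R ^ (k + 1)` with `R < 1`, the
total error is eventually small. -/
lemma exists_sqrt_sum_sq_lt {R : ℝ} (hR0 : 0 ≤ R) (hR : R < 1) {ε : ℝ} (hε : 0 < ε) :
    ∃ K : ℕ, ∀ k : ℕ, K ≤ k → ∀ f : ℕ → ℝ, (∀ j ∈ Finset.Icc 1 k, 0 ≤ f j ∧ f j ≤ R ^ (k + 1)) →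
      √(∑ j ∈ Finset.Icc 1 k, f j ^ 2) < ε := by
  have hlim := tendsto_self_mul_const_pow_of_lt_one hR0 hR
  obtain ⟨K, hK⟩ := Filter.eventually_atTop.1 (hlim.eventually (gt_mem_nhds hε))
  refine ⟨K, fun k hk f hf => lt_of_le_of_lt ?_ (hK k hk)⟩
  refine Real.sqrt_le_iff.2 ⟨by positivity, ?_⟩
  calc ∑ j ∈ Finset.Icc 1 k, f j ^ 2 ≤ ∑ j ∈ Finset.Icc 1 k, (R ^ k) ^ 2 :=
        Finset.sum_le_sum fun j hj => pow_le_pow_left₀ (hf j hj).1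
          ((hf j hj).2.trans (pow_le_pow_of_le_one hR0 hR.le (Nat.le_succ k))) 2
    _ = k * (R ^ k) ^ 2 := by simp
    _ ≤ (k : ℝ) ^ 2 * (R ^ k) ^ 2 := by
        gcongr
        exact_mod_cast Nat.le_self_pow two_ne_zero k
    _ = _ := by ring

end

theorem corollary1 {N M : ℕ} (S : QuadSystem (Fin N)) (q : Fin M → Fin N → ℂ)
    (Q : Matrix (Fin N) (Fin N) ℂ) (Λ : Fin N → ℂ) (x : ℝ → Fin N → ℂ) (X : ℝ)
    -- the nonlinearity and the spectral gap are present
    (hF2 : S.F2 ≠ 0) (hgap : ∃ i, (Λ i).re ≠ 0)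
    -- the linear conserved quantities
    (hq : ∀ m, S.IsConserved (q m))
    -- `F1` is diagonalized by `Q`
    (hQ : IsUnit Q.det) (hdiag : S.F1 = Q * Matrix.diagonal Λ * Q⁻¹)
    -- eigenvalues with non-negative real part are zero and related to conserved quantities:
    -- the corresponding left eigenvectors are combinations of the functionals `(q m)†`
    (hspec : ∀ i, 0 ≤ (Λ i).re →
      Λ i = 0 ∧ Q⁻¹ i ∈ Submodule.span ℂ (Set.range fun m => star (q m)))
    -- `x` is a solution, bounded in the transformed norm
    (hx : S.IsSolution x) (hX : ∀ t, 0 ≤ t → euclNorm (Q⁻¹ *ᵥ x t) ≤ X) :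
    -- the embedding: `[γ x, γ υ]` is the unique solution of the extended undriven system
    (∀ γ υ : ℝ, 0 < γ → υ ≠ 0 →
      ((S.rescale γ).absorb (γ * υ)).IsSolution
          (fun t => appendCoord ((γ : ℂ) • x t) (γ * υ)) ∧
      ∀ z : ℝ → Fin N ⊕ Unit → ℂ, ((S.rescale γ).absorb (γ * υ)).IsSolution z →
        z 0 = appendCoord ((γ : ℂ) • x 0) (γ * υ) →
        ∀ t, 0 ≤ t → z t = appendCoord ((γ : ℂ) • x t) (γ * υ)) ∧
    -- the error bound for every truncation level `k` and every block `j`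
    (∀ υ p γ : ℝ, υ ≠ 0 → 0 < p → p ≤ 1 → γ = p * S.gammaZero Q →
      0 < γ ∧
      ∀ (k : ℕ) (y : (j : ℕ) → ℝ → (Fin j → Fin N ⊕ Unit) → ℂ),
        ((S.rescale γ).absorb (γ * υ)).IsCarlemanSolution k
          (appendCoord ((γ : ℂ) • x 0) (γ * υ)) y →
        ∀ j ∈ Finset.Icc 1 k, ∀ t : ℝ, 0 ≤ t →
          euclNorm (tensorPow ((γ : ℂ) • x t) j - discardExtra (y j t)) ≤
            j / (2 * (k + 1)) * p ^ j * S.Rups Q X υ ^ (k + 1)) ∧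
    -- the optimal choice of `υ`: `υ_*` is, up to sign, the unique minimizer
    (S.F0 ≠ 0 →
      0 < S.upsStar Q ∧ S.Rups Q X (S.upsStar Q) = S.Rdelta Q X ∧
      ∀ υ : ℝ, υ ≠ 0 →
        S.Rdelta Q X ≤ S.Rups Q X υ ∧ (S.Rups Q X υ = S.Rdelta Q X → |υ| = S.upsStar Q)) ∧
    -- the convergence criterion: the total error tends to zero as `k → ∞`, uniformly in time
    (S.Rdelta Q X < 1 →
      ∃ υ : ℝ, 0 < υ ∧ (S.F0 ≠ 0 → υ = S.upsStar Q) ∧ S.Rups Q X υ < 1 ∧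
        ∀ p γ : ℝ, 0 < p → p ≤ 1 → γ = p * S.gammaZero Q →
          ∀ ε : ℝ, 0 < ε → ∃ K : ℕ, ∀ k : ℕ, K ≤ k →
            ∀ y : (j : ℕ) → ℝ → (Fin j → Fin N ⊕ Unit) → ℂ,
              ((S.rescale γ).absorb (γ * υ)).IsCarlemanSolution k
                (appendCoord ((γ : ℂ) • x 0) (γ * υ)) y →
              ∀ t : ℝ, 0 ≤ t →
                √(∑ j ∈ Finset.Icc 1 k,
                  euclNorm (tensorPow ((γ : ℂ) • x t) j - discardExtra (y j t)) ^ 2) < ε) := by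
  have hneg : ∀ i, (Λ i).re ≠ 0 → (Λ i).re < 0 := fun i hi => by
    by_contra h
    exact hi (by rw [(hspec i (not_lt.1 h)).1, Complex.zero_re])
  obtain ⟨hδ, hle⟩ := QuadSystem.realSpectralGap_pos_and_le hQ hdiag hgap hneg
  have hspec' : ∀ i, (Λ i).re ≤ -realSpectralGap S.F1 ∨
      Λ i = 0 ∧ (S.diagonalized Q Λ).F0 i = 0 ∧
      ∀ a b, (S.diagonalized Q Λ).F2 i (a, b) + (S.diagonalized Q Λ).F2 i (b, a) = 0 := fun i => by
    rcases eq_or_ne (Λ i).re 0 with h | h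
    · obtain ⟨h1, h2⟩ := hspec i h.ge
      exact Or.inr ⟨h1, QuadSystem.diagonalized_row_of_mem_span hq Q Λ h2⟩
    · exact Or.inl (hle i h)
  have h2pos : 0 < S.normF2 Q := QuadSystem.normF2_pos hQ hF2
  have hQpos : 0 < ‖Q‖ := by
    obtain ⟨i, -⟩ := hgap
    have : Nonempty (Fin N) := ⟨i⟩
    refine norm_pos_iff.2 fun h => ?_
    rw [h, Matrix.det_zero] at hQ
    exact not_isUnit_zero hQ
  have hγ : ∀ {p γ : ℝ}, 0 < p → γ = p * S.gammaZero Q → 0 < γ := fun hp h => by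
    rw [h, QuadSystem.gammaZero]
    positivity
  have herr := fun {υ p γ : ℝ} (hυ : υ ≠ 0) (hp : 0 < p) (h : γ = p * S.gammaZero Q) =>
    fun {k : ℕ} {y} hy {j : ℕ} (hj : j ∈ Finset.Icc 1 k) {t : ℝ} (ht : 0 ≤ t) =>
    QuadSystem.euclNorm_truncation_error_le_Rups (y := y) hQ hdiag hδ hspec' hx hX hυ hp h
      (hγ hp h) hy (Finset.mem_Icc.1 hj).1 (Finset.mem_Icc.1 hj).2 ht
  have hstar : S.F0 ≠ 0 → 0 < S.upsStar Q := fun h0 =>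
    Real.sqrt_pos.2 (div_pos (QuadSystem.normF0_pos hQ h0) h2pos)
  refine ⟨fun γ υ hγ hυ => ?_, fun υ p γ hυ hp hp1 h => ⟨hγ hp h, fun k y hy j hj t ht =>
    herr hυ hp h hy hj ht⟩, fun h0 => ?_, fun hR => ?_⟩
  · have hsol := QuadSystem.isSolution_absorb_rescale hx hγ.ne' (mul_ne_zero hγ.ne' hυ)
    exact ⟨hsol, fun z hz hz0 t ht => hz.eq_of_eq_zero hsol hz0 t ht⟩
  · have h0pos := QuadSystem.normF0_pos hQ h0
    have hopt := QuadSystem.Rups_upsStar h2pos h0pos X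
    refine ⟨hstar h0, hopt, fun υ hυ => ?_⟩
    rcases eq_or_ne |υ| (S.upsStar Q) with h | h
    · refine ⟨le_of_eq ?_, fun _ => h⟩
      rw [← QuadSystem.Rups_abs, h, hopt]
    · have hlt := QuadSystem.Rdelta_lt_Rups hδ h2pos h0pos X hυ h
      exact ⟨hlt.le, fun h' => absurd h' hlt.ne'⟩
  · obtain ⟨υ, hυ, hυstar, hRυ⟩ : ∃ υ : ℝ, 0 < υ ∧ (S.F0 ≠ 0 → υ = S.upsStar Q) ∧
        S.Rups Q X υ < 1 := by
      by_cases h0 : S.F0 = 0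
      · have hnorm : S.normF0 Q = 0 := by
          simp [QuadSystem.normF0, euclNorm, h0]
        obtain ⟨υ, h1, h2⟩ := QuadSystem.exists_Rups_lt_one hnorm hR
        exact ⟨υ, h1, fun h => absurd h0 h, h2⟩
      · refine ⟨_, hstar h0, fun _ => rfl, ?_⟩
        rwa [QuadSystem.Rups_upsStar h2pos (QuadSystem.normF0_pos hQ h0)]
    refine ⟨υ, hυ, hυstar, hRυ, fun p γ hp hp1 h ε hε => ?_⟩
    have hR0 : 0 ≤ S.Rups Q X υ := by
      have := le_max_of_le_left (b := S.normF2 Q) (c := S.normF0 Q / υ ^ 2) h2pos.le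
      rw [QuadSystem.Rups]
      positivity
    obtain ⟨K, hK⟩ := exists_sqrt_sum_sq_lt hR0 hRυ hε
    refine ⟨K, fun k hk y hy t ht => hK k hk
      (fun j => euclNorm (tensorPow ((γ : ℂ) • x t) j - discardExtra (y j t)))
      fun j hj => ⟨euclNorm_nonneg _, (herr hυ.ne' hp h hy hj ht).trans ?_⟩⟩
    refine mul_le_of_le_one_left (pow_nonneg hR0 _)
      (mul_le_one₀ ?_ (by positivity) (pow_le_one₀ hp.le hp1))
    have hjk : (j : ℝ) ≤ k := by exact_mod_cast (Finset.mem_Icc.1 hj).2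
    rw [div_le_one (by positivity)]
    linarith [Nat.cast_nonneg (α := ℝ) k]
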